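/- Let a finite two-player zero-sum stochastic game be given: $S$ states, $A\ge1$ actions of the max-player (the learner), $B\ge1$ actions of the min-player (the opponent), rewards $r(s,a,b)\in[0,1]$, transition probabilities $P(\cdot\mid s,a,b)$. Assume that for all states $s,s'$ and every Markovian policy $\nu$ of the opponent there is a Markovian policy $\mu$ of the learner under which $s'$ is accessible from $s$, and let $D\ge0$ be an upper bound of the diameter $\max_{s,s'}\max_\nu\min_\mu T^{(\mu,\nu)}_{s\to s'}$, where $T^{(\mu,\nu)}_{s\to s'}$ is the expected time to go from $s$ to $s'$ under $(\mu,\nu)$. Let $J^{(\mu,\nu)}(s)=\lim_{n\to\infty}\frac1n\mathbb E_{(\mu,\nu)}\big[\sum_{t=1}^n r(s_t,a_t,b_t)\mid s_1=s\big]$ be the average reward, and let $J^*$ be the value of the game, i.e. the number (it exists and is unique) with $J^*=\max_\mu\min_\nu J^{(\mu,\nu)}(s)=\min_\nu\max_\mu J^{(\mu,\nu)}(s)$ for every $s$. DONQ-learning with horizon $T\ge1$ and parameters $H>1$ (real) and $\delta=1/T$ sets $\gamma=1-\frac1H$, $\alpha_\tau=\frac{H+1}{H+\tau}$, $\beta_\tau=2D\sqrt{H\log(2T/\delta)/\tau}$,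 and starts from $Q_1=Q^\downarrow_1=V^\downarrow_1=H$, $N_1=0$ and the uniform policy $\mu_1$. In round $t=1,\dots,T$ it observes $s_t$, draws $a_t\sim\mu_t(\cdot\mid s_t)$, observes the opponent's action $b_t$, the reward $r(s_t,a_t,b_t)$ and the next state $s_{t+1}$, and, with $\tau=N_{t+1}(s_t,a_t,b_t)=N_t(s_t,a_t,b_t)+1$, sets $$Q_{t+1}(s_t,a_t,b_t)=(1-\alpha_\tau)Q_t(s_t,a_t,b_t)+\alpha_\tau\big[r(s_t,a_t,b_t)+\gamma V^\downarrow_t(s_{t+1})+\beta_\tau\big],$$ $$Q^\downarrow_{t+1}(s_t,a_t,b_t)=\min\big(Q^\downarrow_t(s_t,a_t,b_t),\,Q_{t+1}(s_t,a_t,b_t)\big);$$ then $(\mu_{t+1}(\cdot\mid s_t),\tilde\nu_{t+1}(\cdot\mid s_t))$ is a Nash equilibrium of the zero-sum matrix game $Q^\downarrow_{t+1}(s_t,\cdot,\cdot)$, computed by a fixed procedure that returns a Nash equilibrium of every matrix game, and $V^\downarrow_{t+1}(s_t)=\mathbb E_{a\sim\mu_{t+1}(\cdot\mid s_t),\,b\sim\tilde\nu_{t+1}(\cdot\mid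 s_t)}\big[Q^\downarrow_{t+1}(s_t,a,b)\big]$; all other entries stay unchanged. The opponent plays an arbitrary history-dependent randomized strategy: given the history up to $s_t$, $b_t$ is drawn independently of $a_t$ from a distribution that may depend on the whole history. The initial state $s_1$ is arbitrary. The regret is $\mathrm{Reg}(T)=\sum_{t=1}^T(J^*-r(s_t,a_t,b_t))$. There is an absolute constant $C$ (independent of the game, $D$, $H$, $T$, the Nash procedure, the opponent and the initial state) such that always $$\mathbb E[\mathrm{Reg}(T)]\le D\frac TH+12D\sqrt{SABHT\log(2T^2)}+C\Big(SABH+D\sqrt{T\log(4T)}\Big).$$ -/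

import Mathlib

open scoped NNReal ENNReal

/-- A finite two-player zero-sum stochastic game with states `S`, actions `A` of the max-player
(the learner) and actions `B` of the min-player (the opponent): rewards `r s a b ∈ [0, 1]` paid to
the max-player, and the distribution `P s a b` of the next state. -/
structure StochasticGame (S A B : Type*) [Fintype S] where
  r : S → A → B → ℝ
  r_mem : ∀ s a b, r s a b ∈ Set.Icc (0 : ℝ) 1
  P : S → A → B → stdSimplex ℝ S

/-- The expected payoff of the matrix game `M` when the players use the mixed actions `x`, `y`. -/
noncomputable def mixedPayoff {A B : Type*} [Fintype A] [Fintype B]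
    (x : stdSimplex ℝ A) (y : stdSimplex ℝ B) (M : A → B → ℝ) : ℝ :=
  ∑ a, ∑ b, x a * y b * M a b

/-- `(x, y)` is a Nash equilibrium of the zero-sum matrix game `M`, in which the row player
maximizes and the column player minimizes. -/
def IsMatrixNash {A B : Type*} [Fintype A] [Fintype B] (M : A → B → ℝ)
    (p : stdSimplex ℝ A × stdSimplex ℝ B) : Prop :=
  (∀ x, mixedPayoff x p.2 M ≤ mixedPayoff p.1 p.2 M) ∧
    ∀ y, mixedPayoff p.1 p.2 M ≤ mixedPayoff p.1 y M

namespace StochasticGame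

/-! ### Markovian policies, average reward, diameter and value -/

section Game

variable {S A B : Type*} [Fintype S] [Fintype A] [Fintype B] (G : StochasticGame S A B)

/-- The expected one-step reward in state `s` under the Markovian policies `μ`, `ν`. -/
noncomputable def policyReward (μ : S → stdSimplex ℝ A) (ν : S → stdSimplex ℝ B) (s : S) : ℝ :=
  mixedPayoff (μ s) (ν s) (G.r s)

/-- The transition matrix of the Markov chain of the states under `μ`, `ν`. -/
noncomputable def transition (μ : S → stdSimplex ℝ A) (ν : S → stdSimplex ℝ B) : Matrix S S ℝ :=
  Matrix.of fun s s' => mixedPayoff (μ s) (ν s) fun a b => G.P s a b s'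

open Classical in
/-- The average reward of `(μ, ν)` from the initial state `s`: the limit of the expected mean
reward over the first `n` steps. The expected reward after `t` steps is the entry `s` of the
`t`-th power of the transition matrix applied to the one-step rewards. (The limit exists for every
finite Markov chain.) -/
noncomputable def avgReward (μ : S → stdSimplex ℝ A) (ν : S → stdSimplex ℝ B) (s : S) : ℝ :=
  Filter.limUnder Filter.atTop fun n : ℕ =>
    (∑ t ∈ Finset.range n, (G.transition μ ν ^ t).mulVec (G.policyReward μ ν) s) / n

/-- `J` is the value of the average-reward game, the same from every initial state:
`J = max_μ min_ν J^(μ,ν)(s) = min_ν max_μ J^(μ,ν)(s)` for every `s`. -/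
def IsValue (J : ℝ) : Prop :=
  ∀ s, IsGreatest (Set.range fun μ : S → stdSimplex ℝ A =>
        ⨅ ν : S → stdSimplex ℝ B, G.avgReward μ ν s) J ∧
    IsLeast (Set.range fun ν : S → stdSimplex ℝ B =>
        ⨆ μ : S → stdSimplex ℝ A, G.avgReward μ ν s) J

open Classical in
/-- For all states `s`, `s'` and every Markovian policy `ν` of the min-player, the max-player has a
Markovian policy `μ` under which `s'` is accessible from `s` with positive probability. -/
def Communicating : Prop :=
  ∀ (s s' : S) (ν : S → stdSimplex ℝ B), ∃ μ : S → stdSimplex ℝ A, ∃ n : ℕ,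
    0 < (G.transition μ ν ^ n) s s'

open Classical in
/-- The probability, under `(μ, ν)` and from `s`, that none of the first `n + 1` states (those at
times `0, …, n`) is `s'`; by conditioning on the first step. -/
noncomputable def avoidProb (μ : S → stdSimplex ℝ A) (ν : S → stdSimplex ℝ B) (s' : S) :
    ℕ → S → ℝ
  | 0, s => if s = s' then 0 else 1
  | n + 1, s => if s = s' then 0 else ∑ u, G.transition μ ν s u * avoidProb μ ν s' n u

/-- The expected time to go from `s` to `s'` under `(μ, ν)`, that is the expectation
`∑ n, ℙ(τ > n)` of the first time `τ ≥ 0` at which the chain started in `s` is in `s'`. It may be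
infinite. -/
noncomputable def hittingTime (μ : S → stdSimplex ℝ A) (ν : S → stdSimplex ℝ B) (s s' : S) :
    ℝ≥0∞ :=
  ∑' n : ℕ, ENNReal.ofReal (G.avoidProb μ ν s' n s)

/-- The diameter of the game, `max_{s, s'} max_ν min_μ` of the expected time from `s` to `s'`. -/
noncomputable def diameter : ℝ≥0∞ :=
  ⨆ (s : S) (s' : S) (ν : S → stdSimplex ℝ B), ⨅ μ : S → stdSimplex ℝ A, G.hittingTime μ ν s s'

end Game

end StochasticGame

/-! ### DONQ-learning -/

/-- The memory of the learner: visit counts `N`, the optimistic estimators `Q`, their non-increasing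
versions `Qd`, the value estimators `V`, and the current policy `μ`. -/
structure DonqMemory (S A B : Type*) [Fintype A] where
  N : S → A → B → ℕ
  Q : S → A → B → ℝ
  Qd : S → A → B → ℝ
  V : S → ℝ
  μ : S → stdSimplex ℝ A

namespace DonqMemory

/-- The initial memory; the initial policy is uniform. -/
noncomputable def init (S A B : Type*) [Fintype A] [Nonempty A] (H : ℝ) : DonqMemory S A B where
  N := fun _ _ _ => 0
  Q := fun _ _ _ => H
  Qd := fun _ _ _ => H
  V := fun _ => H
  μ := fun _ => stdSimplex.barycenter

/-- The learning rate `α_τ`. -/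
noncomputable def rate (H : ℝ) (τ : ℕ) : ℝ := (H + 1) / (H + τ)

/-- The bonus `β_τ`. -/
noncomputable def bonus (D H δ : ℝ) (T τ : ℕ) : ℝ :=
  2 * D * √(H * Real.log (2 * T / δ) / τ)

open Classical in
/-- The update after `(a, b)` was played in state `s`, the reward `ρ` was received and the next
state `s'` was observed. The discount factor is `γ = 1 - 1 / H`; `nash` is the procedure that
computes a pair of Nash policies of a matrix game. -/
noncomputable def update {S A B : Type*} [Fintype A] [Fintype B] (D H δ : ℝ) (T : ℕ)
    (nash : (A → B → ℝ) → stdSimplex ℝ A × stdSimplex ℝ B) (m : DonqMemory S A B)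
    (s : S) (a : A) (b : B) (ρ : ℝ) (s' : S) : DonqMemory S A B :=
  let τ : ℕ := m.N s a b + 1
  let q : ℝ := (1 - rate H τ) * m.Q s a b +
    rate H τ * (ρ + (1 - 1 / H) * m.V s' + bonus D H δ T τ)
  let Qd : S → A → B → ℝ := fun x y z =>
    if x = s ∧ y = a ∧ z = b then min (m.Qd s a b) q else m.Qd x y z
  let p : stdSimplex ℝ A × stdSimplex ℝ B := nash (Qd s)
  { N := fun x y z => if x = s ∧ y = a ∧ z = b then τ else m.N x y z
    Q := fun x y z => if x = s ∧ y = a ∧ z = b then q else m.Q x y z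
    Qd := Qd
    V := fun x => if x = s then mixedPayoff p.1 p.2 (Qd s) else m.V x
    μ := fun x => if x = s then p.1 else m.μ x }

end DonqMemory

namespace StochasticGame

section Play

variable {S A B : Type*} [Fintype S] [Fintype A] [Fintype B] (G : StochasticGame S A B)

/-- The memory of the learner after the finished rounds `past` (a list of the triples (state,
action of the learner, action of the opponent), the most recent round first), when the current
state is the second argument. -/
noncomputable def donqMemory [Nonempty A] (D H δ : ℝ) (T : ℕ)
    (nash : (A → B → ℝ) → stdSimplex ℝ A × stdSimplex ℝ B) :
    List (S × A × B) → S → DonqMemory S A B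
  | [], _ => DonqMemory.init S A B H
  | (s, a, b) :: past, s' =>
      (donqMemory D H δ T nash past s).update D H δ T nash s a b (G.r s a b) s'

/-- The policy of the learner in the round that follows `past`, in the current state `s`. -/
noncomputable def donqPolicy [Nonempty A] (D H δ : ℝ) (T : ℕ)
    (nash : (A → B → ℝ) → stdSimplex ℝ A × stdSimplex ℝ B)
    (past : List (S × A × B)) (s : S) : stdSimplex ℝ A :=
  (G.donqMemory D H δ T nash past s).μ s

/-- The expectation of `f (past, s)`, where `past` lists the first `n` rounds of the game started in
`s₁` and `s` is the state that follows them, for arbitrary history-dependent strategies `σ` and `ω`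
of the two players: in each round the actions are drawn independently from `σ past s` and
`ω past s`, then the next state is drawn from `G.P s a b`. -/
noncomputable def expect (σ : List (S × A × B) → S → stdSimplex ℝ A)
    (ω : List (S × A × B) → S → stdSimplex ℝ B) (s₁ : S) :
    ℕ → (List (S × A × B) × S → ℝ) → ℝ
  | 0, f => f ([], s₁)
  | n + 1, f => expect σ ω s₁ n fun h =>
      ∑ a, ∑ b, ∑ s', σ h.1 h.2 a * ω h.1 h.2 b * G.P h.2 a b s' * f ((h.2, a, b) :: h.1, s')

/-- The regret `∑ (J - r(s, a, b))` over the rounds in `past`, against the reference value `J`. -/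
noncomputable def regret (J : ℝ) (past : List (S × A × B)) : ℝ :=
  (past.map fun x => J - G.r x.1 x.2.1 x.2.2).sum

end Play

end StochasticGame

/-! The game is compared with its `γ`-discounted version, `γ = 1 - 1/H`, whose Shapley value
satisfies `V = val (r + γ P V)`. When the opponent follows the discounted optimal policy, `V` grows
by at most `1` per step in expectation whatever the learner does; running the chain until it hits a
target state shows that `V` has span at most `D` (`IsDiscountedValue.le_add_diameter`). Two things
follow. First, `J ≤ (V s + D) / H` for every `s` (`IsValue.le_of_isDiscountedValue`), which costs `D
T / H`. Second, the sampling noise `V s' - P V` has range `D` instead of `H`, so a bonus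
proportional to `D` suffices. The value `J` itself is obtained by letting `γ → 1`, since the
normalized discounted values stay in a box of size `D` (`exists_isValue`).

At a visited triple, `Q_t - (r + γ P V)` is an averaged bonus plus `γ` times the averages of the
excess `V↓_t - V` and of the noise (`donqMemory_Q_eq`). With high probability the averaged noise is
below the bonus at every visit (`Concentrated`), and induction then gives `V ≤ V↓_t`
(`Concentrated.optimism`).

Inserting `J ≤ (V s_{t+1} + D) / H`, the regret of a round plus its `surplus` is at most `D/H` plus
`Q↓_t - (r + γ P V) - (V↓_t - V)(s_{t+1})` plus `V↓_t(s_{t+1}) - V↓_t(s_t)`. The last difference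
telescopes up to the total decrease of the value estimators. The middle term is at most the
increment of a potential attached to the visited triple (`Concentrated.le_potential_sub`): the
averaged excess is charged against the excess just observed, and only the bonuses and the first
visits remain. The surplus has nonnegative mean, because `μ_t` guarantees `V↓_t(s_t)` against every
mixed action of the opponent (`expect_sumRounds_surplus_nonneg`). Only this mean is needed, so no
martingale fluctuation is paid for and `D √(T log (4T))` is slack. Failure of concentration has
small probability by Azuma–Hoeffding and a union bound (`expect_not_concentrated_le`). -/

/-! ### Matrix games -/

section MatrixGame

variable {A B : Type*} [Fintype A] [Fintype B] {x : stdSimplex ℝ A} {y : stdSimplex ℝ B}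
  {M M' : A → B → ℝ} {p q : stdSimplex ℝ A × stdSimplex ℝ B}

theorem stdSimplex_apply_nonneg (x : stdSimplex ℝ A) (a : A) : 0 ≤ x a := x.2.1 a

theorem stdSimplex_sum_eq_one (x : stdSimplex ℝ A) : ∑ a, x a = 1 := x.2.2

theorem mixedPayoff_mono (h : ∀ a b, M a b ≤ M' a b) : mixedPayoff x y M ≤ mixedPayoff x y M' :=
  Finset.sum_le_sum fun a _ => Finset.sum_le_sum fun b _ =>
    mul_le_mul_of_nonneg_left (h a b)
      (mul_nonneg (stdSimplex_apply_nonneg x a) (stdSimplex_apply_nonneg y b))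

theorem mixedPayoff_add :
    mixedPayoff x y (fun a b => M a b + M' a b) = mixedPayoff x y M + mixedPayoff x y M' := by
  simp only [mixedPayoff, mul_add, Finset.sum_add_distrib]

theorem mixedPayoff_mul_left (c : ℝ) :
    mixedPayoff x y (fun a b => c * M a b) = c * mixedPayoff x y M := by
  simp only [mixedPayoff, Finset.mul_sum]
  exact Finset.sum_congr rfl fun a _ => Finset.sum_congr rfl fun b _ => by ring

theorem mixedPayoff_const (c : ℝ) : mixedPayoff x y (fun _ _ => c) = c := by
  simp only [mixedPayoff, ← Finset.sum_mul, ← Finset.mul_sum, stdSimplex_sum_eq_one, mul_one,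
    one_mul]

theorem mixedPayoff_add_const (c : ℝ) :
    mixedPayoff x y (fun a b => M a b + c) = mixedPayoff x y M + c := by
  rw [mixedPayoff_add, mixedPayoff_const]

/-- The value of a matrix game is monotone and commutes with constants. -/
theorem IsMatrixNash.payoff_le_add (hp : IsMatrixNash M p) (hq : IsMatrixNash M' q) {c : ℝ}
    (h : ∀ a b, M a b ≤ M' a b + c) :
    mixedPayoff p.1 p.2 M ≤ mixedPayoff q.1 q.2 M' + c :=
  calc mixedPayoff p.1 p.2 M ≤ mixedPayoff p.1 q.2 M := hp.2 _
    _ ≤ mixedPayoff p.1 q.2 (fun a b => M' a b + c) := mixedPayoff_mono h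
    _ = mixedPayoff p.1 q.2 M' + c := mixedPayoff_add_const c
    _ ≤ mixedPayoff q.1 q.2 M' + c := by linarith [hq.1 p.1]

theorem IsMatrixNash.payoff_eq_add (hp : IsMatrixNash M p) (hq : IsMatrixNash M' q) {c : ℝ}
    (h : ∀ a b, M a b = M' a b + c) :
    mixedPayoff p.1 p.2 M = mixedPayoff q.1 q.2 M' + c := by
  refine le_antisymm (hp.payoff_le_add hq fun a b => (h a b).le) ?_
  have := hq.payoff_le_add hp (c := -c) fun a b => by rw [h a b]; linarith
  linarith

theorem IsMatrixNash.payoff_mono (hp : IsMatrixNash M p) (hq : IsMatrixNash M' q)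
    (h : ∀ a b, M a b ≤ M' a b) : mixedPayoff p.1 p.2 M ≤ mixedPayoff q.1 q.2 M' := by
  have := hp.payoff_le_add hq (c := 0) fun a b => by linarith [h a b]
  linarith

end MatrixGame

/-! ### Cesàro means of a power bounded operator -/

/-- The Cesàro means of the orbits of a linear map with norm nonincreasing iterates on a
finite-dimensional space converge. -/
theorem LinearMap.exists_tendsto_cesaro_pow {E : Type*} [NormedAddCommGroup E] [NormedSpace ℝ E]
    [FiniteDimensional ℝ E] (f : E →ₗ[ℝ] E) (hf : ∀ n x, ‖(f ^ n) x‖ ≤ ‖x‖) (x : E) :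
    ∃ z, Filter.Tendsto (fun n : ℕ => (n : ℝ)⁻¹ • ∑ t ∈ Finset.range n, (f ^ t) x)
      Filter.atTop (nhds z) := by
  have tel : ∀ (w : E) (n : ℕ),
      ∑ t ∈ Finset.range n, (f ^ t) (f w - w) = (f ^ n) w - w := by
    intro w n
    induction n with
    | zero => simp
    | succ n ih =>
      rw [Finset.sum_range_succ, ih, map_sub, ← Module.End.mul_apply, ← pow_succ]
      abel
  have fix : ∀ z : E, f z = z → ∀ t, (f ^ t) z = z := by
    intro z hz t
    induction t with
    | zero => simp
    | succ t ih => rw [pow_succ, Module.End.mul_apply, hz, ih]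
  have small : ∀ w : E, Filter.Tendsto (fun n : ℕ => (n : ℝ)⁻¹ • ((f ^ n) w - w))
      Filter.atTop (nhds 0) := by
    intro w
    refine squeeze_zero_norm (a := fun n : ℕ => (n : ℝ)⁻¹ * (2 * ‖w‖)) (fun n => ?_) ?_
    · rw [norm_smul, Real.norm_of_nonneg (by positivity)]
      gcongr
      linarith [norm_sub_le ((f ^ n) w) w, hf n w]
    · simpa using tendsto_inv_atTop_nhds_zero_nat.mul_const (2 * ‖w‖)
  -- A fixed vector `y = f w - w` satisfies `n y = f^n w - w`, which is bounded in `n`, so `y = 0`.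
  -- By dimension, range and kernel of `f - 1` then span the space: the means vanish in the limit on
  -- the first and are constant on the second.
  have disj : Disjoint (LinearMap.range (f - 1)) (LinearMap.ker (f - 1)) := by
    rw [Submodule.disjoint_def]
    rintro y ⟨w, rfl⟩ hy
    have hy' : f (f w - w) = f w - w := by
      have := LinearMap.mem_ker.1 hy
      simpa [sub_eq_zero] using this
    have h1 : ∀ n : ℕ, (n : ℝ) • (f w - w) = (f ^ n) w - w := by
      intro n
      rw [← tel w n, Finset.sum_congr rfl fun t _ => fix _ hy' t]
      rw [Finset.sum_const, Finset.card_range, Nat.cast_smul_eq_nsmul]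
    have h2 : Filter.Tendsto (fun _ : ℕ => f w - w) Filter.atTop (nhds 0) := by
      refine (small w).congr' ?_
      filter_upwards [Filter.eventually_gt_atTop 0] with n hn
      rw [← h1, smul_smul, inv_mul_cancel₀ (by positivity), one_smul]
    simpa using tendsto_nhds_unique tendsto_const_nhds h2
  have top : LinearMap.range (f - 1) ⊔ LinearMap.ker (f - 1) = ⊤ := by
    refine Submodule.eq_top_of_disjoint _ _ ?_ disj
    rw [LinearMap.finrank_range_add_finrank_ker]
  obtain ⟨y, ⟨w, rfl⟩, z, hz, rfl⟩ := Submodule.mem_sup.1 (top ▸ Submodule.mem_top (x := x))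
  have hz' : f z = z := by
    have := LinearMap.mem_ker.1 hz
    simpa [sub_eq_zero] using this
  refine ⟨0 + z, ((small w).add_const z).congr' ?_⟩
  filter_upwards [Filter.eventually_gt_atTop 0] with n hn
  have : (f - 1) w = f w - w := rfl
  simp only [map_add, Finset.sum_add_distrib, this, tel, smul_add]
  rw [Finset.sum_congr rfl fun t _ => fix _ hz' t]
  simp only [Finset.sum_const, Finset.card_range]
  rw [← Nat.cast_smul_eq_nsmul ℝ, smul_smul, inv_mul_cancel₀ (by positivity), one_smul]

/-! ### One-step expectations and average rewards of Markovian policies -/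

namespace StochasticGame

section NextValue

variable {S A B : Type*} [Fintype S] (G : StochasticGame S A B)

/-- The expectation of `V` in the next state, after the actions `a`, `b` in state `s`. -/
noncomputable def nextValue (V : S → ℝ) (s : S) (a : A) (b : B) : ℝ :=
  ∑ s', G.P s a b s' * V s'

variable {G}

theorem nextValue_mono {V W : S → ℝ} (h : ∀ s, V s ≤ W s) (s : S) (a : A) (b : B) :
    G.nextValue V s a b ≤ G.nextValue W s a b :=
  Finset.sum_le_sum fun u _ => mul_le_mul_of_nonneg_left (h u) (stdSimplex_apply_nonneg _ u)

theorem nextValue_const (c : ℝ) (s : S) (a : A) (b : B) :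
    G.nextValue (fun _ => c) s a b = c := by
  simp only [nextValue, ← Finset.sum_mul, stdSimplex_sum_eq_one, one_mul]

theorem nextValue_add (V W : S → ℝ) (s : S) (a : A) (b : B) :
    G.nextValue (fun u => V u + W u) s a b = G.nextValue V s a b + G.nextValue W s a b := by
  simp only [nextValue, mul_add, Finset.sum_add_distrib]

theorem nextValue_mul_left (c : ℝ) (V : S → ℝ) (s : S) (a : A) (b : B) :
    G.nextValue (fun u => c * V u) s a b = c * G.nextValue V s a b := by
  simp only [nextValue, Finset.mul_sum]
  exact Finset.sum_congr rfl fun u _ => by ring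

theorem nextValue_le {V : S → ℝ} {c : ℝ} (h : ∀ s, V s ≤ c) (s : S) (a : A) (b : B) :
    G.nextValue V s a b ≤ c :=
  (nextValue_mono h s a b).trans_eq (nextValue_const c s a b)

theorem le_nextValue {V : S → ℝ} {c : ℝ} (h : ∀ s, c ≤ V s) (s : S) (a : A) (b : B) :
    c ≤ G.nextValue V s a b :=
  (nextValue_const c s a b).symm.trans_le (nextValue_mono h s a b)

end NextValue

section Game

variable {S A B : Type*} [Fintype S] [Fintype A] [Fintype B] {G : StochasticGame S A B}

theorem transition_mulVec (μ : S → stdSimplex ℝ A) (ν : S → stdSimplex ℝ B) (V : S → ℝ) (s : S) :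
    (G.transition μ ν).mulVec V s = mixedPayoff (μ s) (ν s) (G.nextValue V s) := by
  simp only [Matrix.mulVec, dotProduct, transition, Matrix.of_apply, mixedPayoff, nextValue,
    Finset.sum_mul, Finset.mul_sum]
  rw [Finset.sum_comm]
  refine Finset.sum_congr rfl fun a _ => ?_
  rw [Finset.sum_comm]
  exact Finset.sum_congr rfl fun b _ => Finset.sum_congr rfl fun u _ => by ring

theorem transition_mulVec_mono (μ : S → stdSimplex ℝ A) (ν : S → stdSimplex ℝ B) {V W : S → ℝ}
    (h : ∀ s, V s ≤ W s) (s : S) :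
    (G.transition μ ν).mulVec V s ≤ (G.transition μ ν).mulVec W s := by
  rw [transition_mulVec, transition_mulVec]
  exact mixedPayoff_mono fun a b => nextValue_mono h s a b

theorem transition_mulVec_const (μ : S → stdSimplex ℝ A) (ν : S → stdSimplex ℝ B) (c : ℝ) :
    (G.transition μ ν).mulVec (fun _ => c) = fun _ => c := by
  funext s
  rw [transition_mulVec, show G.nextValue (fun _ => c) s = fun _ _ => c from
    funext fun a => funext fun b => nextValue_const c s a b, mixedPayoff_const]

open Classical in
theorem transition_pow_mulVec_mono (μ : S → stdSimplex ℝ A) (ν : S → stdSimplex ℝ B) (n : ℕ)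
    {V W : S → ℝ} (h : ∀ s, V s ≤ W s) (s : S) :
    (G.transition μ ν ^ n).mulVec V s ≤ (G.transition μ ν ^ n).mulVec W s := by
  induction n generalizing s with
  | zero => simpa using h s
  | succ n ih =>
    rw [pow_succ', ← Matrix.mulVec_mulVec, ← Matrix.mulVec_mulVec]
    exact transition_mulVec_mono μ ν ih s

open Classical in
theorem transition_pow_mulVec_const (μ : S → stdSimplex ℝ A) (ν : S → stdSimplex ℝ B) (n : ℕ)
    (c : ℝ) : (G.transition μ ν ^ n).mulVec (fun _ => c) = fun _ => c := by
  induction n with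
  | zero => simp
  | succ n ih => rw [pow_succ', ← Matrix.mulVec_mulVec, ih, transition_mulVec_const]

open Classical in
theorem norm_transition_pow_mulVec_le (μ : S → stdSimplex ℝ A) (ν : S → stdSimplex ℝ B) (n : ℕ)
    (V : S → ℝ) : ‖(G.transition μ ν ^ n).mulVec V‖ ≤ ‖V‖ := by
  refine (pi_norm_le_iff_of_nonneg (norm_nonneg V)).2 fun s => abs_le.2 ⟨?_, ?_⟩
  · have := transition_pow_mulVec_mono (G := G) μ ν n (V := fun _ => -‖V‖) (W := V)
      (fun u => (abs_le.1 (norm_le_pi_norm V u)).1) s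
    rwa [transition_pow_mulVec_const] at this
  · have := transition_pow_mulVec_mono (G := G) μ ν n (V := V) (W := fun _ => ‖V‖)
      (fun u => (abs_le.1 (norm_le_pi_norm V u)).2) s
    rwa [transition_pow_mulVec_const] at this

open Classical in
-- `avgReward` is a `limUnder`, so it carries information only once the limit exists; stochastic
-- matrices are sup-norm contractions, and the mean ergodic theorem applies.
theorem tendsto_avgReward (μ : S → stdSimplex ℝ A) (ν : S → stdSimplex ℝ B) (s : S) :
    Filter.Tendsto (fun n : ℕ =>
      (∑ t ∈ Finset.range n, (G.transition μ ν ^ t).mulVec (G.policyReward μ ν) s) / n)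
      Filter.atTop (nhds (G.avgReward μ ν s)) := by
  have key : ∀ n (V : S → ℝ), ((G.transition μ ν).mulVecLin ^ n) V =
      (G.transition μ ν ^ n).mulVec V := by
    intro n V
    rw [← Matrix.toLin'_apply', ← Matrix.toLin'_pow, Matrix.toLin'_apply]
  obtain ⟨z, hz⟩ := (G.transition μ ν).mulVecLin.exists_tendsto_cesaro_pow
    (fun n V => by rw [key]; exact norm_transition_pow_mulVec_le μ ν n V) (G.policyReward μ ν)
  refine tendsto_nhds_limUnder ⟨z s, ?_⟩
  refine ((tendsto_pi_nhds.1 hz) s).congr fun n => ?_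
  simp only [key, Pi.smul_apply, Finset.sum_apply, smul_eq_mul]
  rw [div_eq_inv_mul]

/-- If `W` satisfies `r + P W ≤ J + W` under `(μ, ν)`, the average reward is at most `J`. -/
theorem avgReward_le_of_le (μ : S → stdSimplex ℝ A) (ν : S → stdSimplex ℝ B) (W : S → ℝ) (J : ℝ)
    (h : ∀ s, mixedPayoff (μ s) (ν s) (fun a b => G.r s a b + G.nextValue W s a b) ≤ J + W s)
    (s : S) : G.avgReward μ ν s ≤ J := by
  classical
  have hstep : ∀ s, G.policyReward μ ν s ≤ J + W s - (G.transition μ ν).mulVec W s := by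
    intro s
    have := h s
    rw [mixedPayoff_add] at this
    rw [transition_mulVec, policyReward]
    linarith
  -- Applying `P^t` to the one-step inequality makes the `W` terms telescope; what remains is
  -- bounded by `2 ‖W‖` and disappears after division by `n`.
  have hsum : ∀ n : ℕ, ∑ t ∈ Finset.range n,
      (G.transition μ ν ^ t).mulVec (G.policyReward μ ν) s ≤
        n * J + (W s - (G.transition μ ν ^ n).mulVec W s) := by
    intro n
    induction n with
    | zero => simp
    | succ n ih =>
      rw [Finset.sum_range_succ]
      have h1 := transition_pow_mulVec_mono (G := G) μ ν n hstep s
      have h2 : (fun s => J + W s - (G.transition μ ν).mulVec W s) =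
          (fun _ => J) + W - (G.transition μ ν).mulVec W := rfl
      rw [h2, Matrix.mulVec_sub, Matrix.mulVec_add, transition_pow_mulVec_const,
        Matrix.mulVec_mulVec, ← pow_succ] at h1
      simp only [Pi.add_apply, Pi.sub_apply] at h1
      push_cast
      linarith
  have hlim : Filter.Tendsto (fun n : ℕ => J + (2 * ‖W‖) / n) Filter.atTop (nhds (J + 0)) :=
    (tendsto_const_div_atTop_nhds_zero_nat _).const_add J
  rw [add_zero] at hlim
  refine le_of_tendsto_of_tendsto (tendsto_avgReward μ ν s) hlim ?_
  filter_upwards [Filter.eventually_gt_atTop 0] with n hn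
  have hn' : (0 : ℝ) < n := by exact_mod_cast hn
  have h1 := abs_le.1 (norm_le_pi_norm W s)
  have h2 := abs_le.1 ((norm_le_pi_norm ((G.transition μ ν ^ n).mulVec W) s).trans
    (norm_transition_pow_mulVec_le μ ν n W))
  rw [div_le_iff₀ hn', add_mul, div_mul_cancel₀ _ hn'.ne']
  linarith [hsum n]

/-- If `W` satisfies `J + W ≤ r + P W` under `(μ, ν)`, the average reward is at least `J`. -/
theorem le_avgReward_of_le (μ : S → stdSimplex ℝ A) (ν : S → stdSimplex ℝ B) (W : S → ℝ) (J : ℝ)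
    (h : ∀ s, J + W s ≤ mixedPayoff (μ s) (ν s) (fun a b => G.r s a b + G.nextValue W s a b))
    (s : S) : J ≤ G.avgReward μ ν s := by
  classical
  have hstep : ∀ s, J + W s - (G.transition μ ν).mulVec W s ≤ G.policyReward μ ν s := by
    intro s
    have := h s
    rw [mixedPayoff_add] at this
    rw [transition_mulVec, policyReward]
    linarith
  have hsum : ∀ n : ℕ, n * J + (W s - (G.transition μ ν ^ n).mulVec W s) ≤
      ∑ t ∈ Finset.range n, (G.transition μ ν ^ t).mulVec (G.policyReward μ ν) s := by
    intro n
    induction n with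
    | zero => simp
    | succ n ih =>
      rw [Finset.sum_range_succ]
      have h1 := transition_pow_mulVec_mono (G := G) μ ν n hstep s
      have h2 : (fun s => J + W s - (G.transition μ ν).mulVec W s) =
          (fun _ => J) + W - (G.transition μ ν).mulVec W := rfl
      rw [h2, Matrix.mulVec_sub, Matrix.mulVec_add, transition_pow_mulVec_const,
        Matrix.mulVec_mulVec, ← pow_succ] at h1
      simp only [Pi.add_apply, Pi.sub_apply] at h1
      push_cast
      linarith
  have hlim : Filter.Tendsto (fun n : ℕ => J - (2 * ‖W‖) / n) Filter.atTop (nhds (J - 0)) :=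
    (tendsto_const_div_atTop_nhds_zero_nat _).const_sub J
  rw [sub_zero] at hlim
  refine le_of_tendsto_of_tendsto hlim (tendsto_avgReward μ ν s) ?_
  filter_upwards [Filter.eventually_gt_atTop 0] with n hn
  have hn' : (0 : ℝ) < n := by exact_mod_cast hn
  have h1 := abs_le.1 (norm_le_pi_norm W s)
  have h2 := abs_le.1 ((norm_le_pi_norm ((G.transition μ ν ^ n).mulVec W) s).trans
    (norm_transition_pow_mulVec_le μ ν n W))
  rw [le_div_iff₀ hn', sub_mul, div_mul_cancel₀ _ hn'.ne']
  linarith [hsum n]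

theorem avgReward_mem_Icc (μ : S → stdSimplex ℝ A) (ν : S → stdSimplex ℝ B) (s : S) :
    G.avgReward μ ν s ∈ Set.Icc (0 : ℝ) 1 := by
  constructor
  · refine le_avgReward_of_le μ ν (fun _ => 0) 0 (fun s => ?_) s
    simp only [nextValue_const, add_zero]
    rw [← mixedPayoff_const (x := μ s) (y := ν s) 0]
    exact mixedPayoff_mono fun a b => (G.r_mem s a b).1
  · refine avgReward_le_of_le μ ν (fun _ => 0) 1 (fun s => ?_) s
    simp only [nextValue_const, add_zero]
    rw [← mixedPayoff_const (x := μ s) (y := ν s) 1]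
    exact mixedPayoff_mono fun a b => (G.r_mem s a b).2

/-! ### The value of the game from a solution of the optimality equation -/

/-- A solution `(J, W)` of the optimality equation `J + W = val (r + P W)` gives the value of the
game. -/
theorem isValue_of_optimality [Nonempty A] [Nonempty B] (J : ℝ) (W : S → ℝ)
    (p : S → stdSimplex ℝ A × stdSimplex ℝ B)
    (hp : ∀ s, IsMatrixNash (fun a b => G.r s a b + G.nextValue W s a b) (p s))
    (h : ∀ s, J + W s =
      mixedPayoff (p s).1 (p s).2 (fun a b => G.r s a b + G.nextValue W s a b)) :
    G.IsValue J := by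
  have lo : ∀ ν s, J ≤ G.avgReward (fun s => (p s).1) ν s := fun ν s =>
    le_avgReward_of_le _ ν W J (fun s => (h s).trans_le ((hp s).2 _)) s
  have hi : ∀ μ s, G.avgReward μ (fun s => (p s).2) s ≤ J := fun μ s =>
    avgReward_le_of_le μ _ W J (fun s => ((hp s).1 _).trans_eq (h s).symm) s
  have bb : ∀ μ s, BddBelow (Set.range fun ν => G.avgReward μ ν s) := fun μ s =>
    ⟨0, by rintro _ ⟨ν, rfl⟩; exact (avgReward_mem_Icc μ ν s).1⟩
  have ba : ∀ ν s, BddAbove (Set.range fun μ => G.avgReward μ ν s) := fun ν s =>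
    ⟨1, by rintro _ ⟨μ, rfl⟩; exact (avgReward_mem_Icc μ ν s).2⟩
  have hinf : ∀ μ s, ⨅ ν, G.avgReward μ ν s ≤ J := fun μ s => (ciInf_le (bb μ s) _).trans (hi μ s)
  have hsup : ∀ ν s, J ≤ ⨆ μ, G.avgReward μ ν s := fun ν s =>
    (lo ν s).trans (le_ciSup (ba ν s) fun s => (p s).1)
  refine fun s => ⟨⟨⟨fun s => (p s).1, ?_⟩, ?_⟩, ⟨⟨fun s => (p s).2, ?_⟩, ?_⟩⟩
  · exact le_antisymm (hinf _ s) (le_ciInf fun ν => lo ν s)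
  · rintro _ ⟨μ, rfl⟩
    exact hinf μ s
  · exact le_antisymm (ciSup_le fun μ => hi μ s) (hsup _ s)
  · rintro _ ⟨ν, rfl⟩
    exact hsup ν s

/-- If `val (r + P W) ≤ c + W`, then the value of the game is at most `c`. -/
theorem IsValue.le_of_le {J : ℝ} (hJ : G.IsValue J) [Nonempty A] (c : ℝ) (W : S → ℝ)
    (ν : S → stdSimplex ℝ B)
    (h : ∀ s μ, mixedPayoff μ (ν s) (fun a b => G.r s a b + G.nextValue W s a b) ≤ c + W s)
    (s : S) : J ≤ c := by
  refine ((hJ s).2.2 ⟨ν, rfl⟩).trans (ciSup_le fun μ => ?_)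
  exact avgReward_le_of_le μ ν W c (fun s => h s (μ s)) s

theorem IsValue.mem_Icc {J : ℝ} (hJ : G.IsValue J) [Nonempty A] [Nonempty B] (s : S) :
    J ∈ Set.Icc (0 : ℝ) 1 := by
  obtain ⟨⟨⟨μ, hμ⟩, -⟩, ⟨ν, hν⟩, -⟩ := hJ s
  refine ⟨hμ ▸ le_ciInf fun ν => (avgReward_mem_Icc μ ν s).1,
    hν ▸ ciSup_le fun μ => (avgReward_mem_Icc μ ν s).2⟩

end Game

end StochasticGame

/-- The equilibrium may jump with the matrix, but the value is 1-Lipschitz for the sup distance. -/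
theorem IsMatrixNash.continuous_payoff {A B : Type*} [Fintype A] [Fintype B]
    {nash : (A → B → ℝ) → stdSimplex ℝ A × stdSimplex ℝ B} (hnash : ∀ M, IsMatrixNash M (nash M)) :
    Continuous fun M => mixedPayoff (nash M).1 (nash M).2 M := by
  refine (LipschitzWith.of_le_add fun M M' => ?_).continuous
  refine (hnash M).payoff_le_add (hnash M') fun a b => ?_
  have h1 := (dist_le_pi_dist (M a) (M' a) b).trans (dist_le_pi_dist M M' a)
  rw [Real.dist_eq] at h1
  linarith [(abs_le.1 h1).2]

namespace StochasticGame

/-! ### The discounted game -/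

section Game

variable {S A B : Type*} [Fintype S] [Fintype A] [Fintype B] (G : StochasticGame S A B)

/-- The payoff `r + γ P V` of the one-stage game with continuation value `V`. -/
noncomputable def stagePayoff (γ : ℝ) (V : S → ℝ) (s : S) (a : A) (b : B) : ℝ :=
  G.r s a b + γ * G.nextValue V s a b

/-- `V` is the value of the `γ`-discounted game, and `p` are optimal stationary policies. -/
def IsDiscountedValue (γ : ℝ) (V : S → ℝ) (p : S → stdSimplex ℝ A × stdSimplex ℝ B) : Prop :=
  ∀ s, IsMatrixNash (G.stagePayoff γ V s) (p s) ∧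
    V s = mixedPayoff (p s).1 (p s).2 (G.stagePayoff γ V s)

variable {G}

/-- Shapley's argument: the matrix-game value is nonexpansive, so `V ↦ val (r + γ P V)` is a
`γ`-contraction. -/
theorem exists_isDiscountedValue
    {nash : (A → B → ℝ) → stdSimplex ℝ A × stdSimplex ℝ B} (hnash : ∀ M, IsMatrixNash M (nash M))
    {γ : ℝ} (hγ0 : 0 ≤ γ) (hγ1 : γ < 1) :
    ∃ V : S → ℝ, G.IsDiscountedValue γ V fun s => nash (G.stagePayoff γ V s) := by
  let F : (S → ℝ) → S → ℝ := fun V s =>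
    mixedPayoff (nash (G.stagePayoff γ V s)).1 (nash (G.stagePayoff γ V s)).2 (G.stagePayoff γ V s)
  have key : ∀ V W s, F V s ≤ F W s + γ * dist V W := by
    intro V W s
    refine (hnash _).payoff_le_add (hnash _) fun a b => ?_
    have h1 : G.nextValue V s a b ≤ G.nextValue W s a b + dist V W := by
      rw [← nextValue_const (G := G) (dist V W) s a b, ← nextValue_add]
      refine nextValue_mono (fun u => ?_) s a b
      have := dist_le_pi_dist V W u
      rw [Real.dist_eq] at this
      linarith [(abs_le.1 this).2]
    have := mul_le_mul_of_nonneg_left h1 hγ0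
    simp only [stagePayoff]
    linarith
  have hF : ContractingWith (NNReal.mk γ hγ0) F := by
    refine ⟨NNReal.coe_lt_coe.1 (by simpa using hγ1), LipschitzWith.of_dist_le_mul fun V W => ?_⟩
    refine (dist_pi_le_iff (by positivity)).2 fun s => ?_
    rw [Real.dist_eq, NNReal.coe_mk]
    have h1 := key V W s
    have h2 := key W V s
    rw [dist_comm] at h2
    exact abs_le.2 ⟨by linarith, by linarith⟩
  exact ⟨hF.fixedPoint F, fun s => ⟨hnash _, (congrFun hF.fixedPoint_isFixedPt s).symm⟩⟩

variable {γ : ℝ} {V : S → ℝ} {p : S → stdSimplex ℝ A × stdSimplex ℝ B}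

theorem IsDiscountedValue.nonneg (hV : G.IsDiscountedValue γ V p) (hγ0 : 0 ≤ γ) (hγ1 : γ < 1)
    (s : S) : 0 ≤ V s := by
  have : Nonempty S := ⟨s⟩
  obtain ⟨m, hm⟩ := Finite.exists_min V
  suffices 0 ≤ V m from this.trans (hm s)
  have h1 : γ * V m ≤ V m := by
    conv_rhs => rw [(hV m).2]
    rw [← mixedPayoff_const (x := (p m).1) (y := (p m).2) (γ * V m)]
    refine mixedPayoff_mono fun a b => ?_
    have := mul_le_mul_of_nonneg_left (le_nextValue (G := G) hm m a b) hγ0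
    simp only [stagePayoff]
    linarith [(G.r_mem m a b).1]
  nlinarith

theorem IsDiscountedValue.mul_le_one (hV : G.IsDiscountedValue γ V p) (hγ0 : 0 ≤ γ) (hγ1 : γ < 1)
    (s : S) : (1 - γ) * V s ≤ 1 := by
  have : Nonempty S := ⟨s⟩
  obtain ⟨m, hm⟩ := Finite.exists_max V
  have h1 : V m ≤ 1 + γ * V m := by
    conv_lhs => rw [(hV m).2]
    rw [← mixedPayoff_const (x := (p m).1) (y := (p m).2) (1 + γ * V m)]
    refine mixedPayoff_mono fun a b => ?_
    have := mul_le_mul_of_nonneg_left (nextValue_le (G := G) hm m a b) hγ0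
    simp only [stagePayoff]
    linarith [(G.r_mem m a b).2]
  have := mul_le_mul_of_nonneg_left (hm s) (sub_nonneg.2 hγ1.le)
  linarith

theorem IsDiscountedValue.le_horizon {H : ℝ} (hV : G.IsDiscountedValue (1 - 1 / H) V p)
    (hH : 1 < H) (u : S) : V u ≤ H := by
  have hH0 : 0 < H := zero_lt_one.trans hH
  have := hV.mul_le_one (sub_nonneg.2 ((div_le_one hH0).2 hH.le)) (sub_lt_self _ (by positivity)) u
  rwa [sub_sub_cancel, one_div, inv_mul_le_iff₀ hH0, mul_one] at this

/-- Optimality of the opponent's policy gives `r + γ P V ≤ V` against every `μ`, while the missing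
part `(1 - γ) P V` is at most `1`. -/
theorem IsDiscountedValue.nextValue_le_add (hV : G.IsDiscountedValue γ V p) (hγ0 : 0 ≤ γ)
    (hγ1 : γ < 1) (μ : S → stdSimplex ℝ A) (s : S) :
    mixedPayoff (μ s) (p s).2 (G.nextValue V s) ≤ V s + 1 := by
  calc mixedPayoff (μ s) (p s).2 (G.nextValue V s)
      ≤ mixedPayoff (μ s) (p s).2 (fun a b => G.stagePayoff γ V s a b + 1) := by
        refine mixedPayoff_mono fun a b => ?_
        have : (1 - γ) * G.nextValue V s a b ≤ 1 := by
          have h := nextValue_le (G := G) (V := fun u => (1 - γ) * V u)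
            (fun u => hV.mul_le_one hγ0 hγ1 u) s a b
          rwa [nextValue_mul_left] at h
        simp only [stagePayoff]
        linarith [(G.r_mem s a b).1]
    _ ≤ V s + 1 := by
        rw [mixedPayoff_add_const]
        linarith [(hV s).1.1 (μ s), (hV s).2]

/-- A function that increases by at most `1` per step in expectation (under `(μ, ν)`) increases by
at most the hitting time. -/
theorem le_add_of_hittingTime_le (μ : S → stdSimplex ℝ A) (ν : S → stdSimplex ℝ B) (V : S → ℝ)
    (hV : ∀ s, mixedPayoff (μ s) (ν s) (G.nextValue V s) ≤ V s + 1) {s s' : S} {d : ℝ}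
    (hd : 0 ≤ d) (hT : G.hittingTime μ ν s s' ≤ ENNReal.ofReal d) : V s' ≤ V s + d := by
  classical
  have avoid_nonneg : ∀ n u, 0 ≤ G.avoidProb μ ν s' n u := by
    intro n
    induction n with
    | zero => intro u; simp only [avoidProb]; split_ifs <;> norm_num
    | succ n ih =>
      intro u
      simp only [avoidProb]
      split_ifs
      · exact le_rfl
      · refine Finset.sum_nonneg fun v _ => mul_nonneg ?_ (ih v)
        have := mixedPayoff_mono (x := μ u) (y := ν u) (M := fun _ _ => 0)
          (M' := fun a b => G.P u a b v) fun a b => stdSimplex_apply_nonneg _ v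
        rwa [mixedPayoff_const] at this
  -- Optional stopping at the hitting time truncated at `n`; the second term pays for the paths that
  -- have not yet arrived.
  have bound : ∀ n u, V s' - V u ≤ ∑ k ∈ Finset.range n, G.avoidProb μ ν s' k u +
      2 * ‖V‖ * G.avoidProb μ ν s' n u := by
    intro n
    induction n with
    | zero =>
      intro u
      simp only [avoidProb, Finset.range_zero, Finset.sum_empty]
      split_ifs with h
      · subst h; simp
      · have h1 := abs_le.1 (norm_le_pi_norm V u)
        have h2 := abs_le.1 (norm_le_pi_norm V s')
        linarith
    | succ n ih =>
      intro u
      by_cases h : u = s'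
      · subst h
        rw [sub_self]
        exact add_nonneg (Finset.sum_nonneg fun k _ => avoid_nonneg k _)
          (mul_nonneg (by positivity) (avoid_nonneg _ _))
      · have h1 := transition_mulVec_mono (G := G) μ ν ih u
        have h2 : (fun v => V s' - V v) = (fun _ => V s') - V := rfl
        rw [h2, Matrix.mulVec_sub, Pi.sub_apply, transition_mulVec_const, transition_mulVec] at h1
        have h3 : (G.transition μ ν).mulVec (fun v => ∑ k ∈ Finset.range n, G.avoidProb μ ν s' k v +
            2 * ‖V‖ * G.avoidProb μ ν s' n v) u =
            ∑ k ∈ Finset.range n, G.avoidProb μ ν s' (k + 1) u +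
              2 * ‖V‖ * G.avoidProb μ ν s' (n + 1) u := by
          simp only [avoidProb, h, if_false, Matrix.mulVec, dotProduct, mul_add,
            Finset.sum_add_distrib, Finset.mul_sum]
          rw [Finset.sum_comm]
          congr 1
          exact Finset.sum_congr rfl fun v _ => by ring
        rw [h3] at h1
        rw [Finset.sum_range_succ']
        simp only [avoidProb, h, if_false] at h1 ⊢
        linarith [hV u]
  have hsum : Summable fun n => G.avoidProb μ ν s' n s := by
    have h1 : ∑' n, ENNReal.ofReal (G.avoidProb μ ν s' n s) ≠ ⊤ :=
      ne_top_of_le_ne_top ENNReal.ofReal_ne_top hT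
    refine (ENNReal.summable_toReal h1).congr fun n => ?_
    exact ENNReal.toReal_ofReal (avoid_nonneg n s)
  have hle : ∑' n, G.avoidProb μ ν s' n s ≤ d := by
    rw [hittingTime, ← ENNReal.ofReal_tsum_of_nonneg (fun n => avoid_nonneg n s) hsum] at hT
    exact (ENNReal.ofReal_le_ofReal_iff hd).1 hT
  -- A finite expected hitting time makes the avoidance probabilities summable, so the truncation
  -- error vanishes.
  have hlim : Filter.Tendsto (fun n => d + 2 * ‖V‖ * G.avoidProb μ ν s' n s) Filter.atTop
      (nhds (d + 2 * ‖V‖ * 0)) := (hsum.tendsto_atTop_zero.const_mul _).const_add _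
  have := ge_of_tendsto' hlim fun n => (bound n s).trans
    (add_le_add_left ((hsum.sum_le_tsum _ fun k _ => avoid_nonneg k s).trans hle) _)
  linarith

/-- The diameter is used against the discounted optimal policy of the opponent. The infimum over `μ`
need not be known to be attained, hence the slack `ε`. -/
theorem IsDiscountedValue.le_add_diameter (hV : G.IsDiscountedValue γ V p) (hγ0 : 0 ≤ γ)
    (hγ1 : γ < 1) {D : ℝ≥0} (hD : G.diameter ≤ (D : ℝ≥0∞)) (s s' : S) : V s' ≤ V s + D := by
  refine le_of_forall_pos_le_add fun ε hε => ?_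
  have h1 : ⨅ μ : S → stdSimplex ℝ A, G.hittingTime μ (fun s => (p s).2) s s' ≤ (D : ℝ≥0∞) :=
    (le_iSup₂_of_le s s' (le_iSup (fun ν : S → stdSimplex ℝ B =>
      ⨅ μ : S → stdSimplex ℝ A, G.hittingTime μ ν s s') fun s => (p s).2)).trans hD
  have h2 : (D : ℝ≥0∞) < ENNReal.ofReal (D + ε) := by
    rw [← ENNReal.ofReal_coe_nnreal]
    exact (ENNReal.ofReal_lt_ofReal_iff_of_nonneg D.coe_nonneg).2 (lt_add_of_pos_right _ hε)
  obtain ⟨μ, hμ⟩ := iInf_lt_iff.1 (h1.trans_lt h2)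
  rw [add_assoc]
  exact le_add_of_hittingTime_le μ _ V (fun s => hV.nextValue_le_add hγ0 hγ1 μ s)
    (add_nonneg D.coe_nonneg hε.le) hμ.le

/-- The gain is close to the normalized discounted value. -/
theorem IsValue.le_of_isDiscountedValue [Nonempty A] {J : ℝ} (hJ : G.IsValue J)
    (hV : G.IsDiscountedValue γ V p) (hγ0 : 0 ≤ γ) (hγ1 : γ < 1) {D : ℝ≥0}
    (hD : G.diameter ≤ (D : ℝ≥0∞)) (s : S) : J ≤ (1 - γ) * (V s + D) := by
  refine hJ.le_of_le _ V (fun s => (p s).2) (fun u μ => ?_) s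
  calc mixedPayoff μ (p u).2 (fun a b => G.r u a b + G.nextValue V u a b)
      ≤ mixedPayoff μ (p u).2 (fun a b => G.stagePayoff γ V u a b + (1 - γ) * (V s + D)) := by
        refine mixedPayoff_mono fun a b => ?_
        have := mul_le_mul_of_nonneg_left (nextValue_le (G := G)
          (fun v => hV.le_add_diameter hγ0 hγ1 hD s v) u a b) (sub_nonneg.2 hγ1.le)
        simp only [stagePayoff]
        linarith
    _ ≤ (1 - γ) * (V s + D) + V u := by
        rw [mixedPayoff_add_const]
        linarith [(hV u).1.1 μ, (hV u).2]

/-- Limits of solutions of discounted optimality equations solve the undiscounted one. -/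
theorem exists_optimality_of_tendsto {val : ℝ → (S → ℝ) → S → ℝ}
    (hval : Continuous fun x : ℝ × (S → ℝ) => val x.1 x.2) {g j : ℕ → ℝ} {W : ℕ → S → ℝ}
    (hg : Filter.Tendsto g Filter.atTop (nhds 1)) (heq : ∀ k s, j k + W k s = val (g k) (W k) s)
    {D : ℝ} (hj : ∀ k, j k ∈ Set.Icc (0 : ℝ) 1) (hW : ∀ k s, W k s ∈ Set.Icc (-D) D) :
    ∃ (J : ℝ) (W' : S → ℝ), ∀ s, J + W' s = val 1 W' s := by
  have hmem : ∀ k, (j k, W k) ∈ Set.Icc (0 : ℝ) 1 ×ˢ Set.pi Set.univ fun _ : S => Set.Icc (-D) D :=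
    fun k => ⟨hj k, fun s _ => hW k s⟩
  obtain ⟨⟨J, W'⟩, -, φ, hφ, hlim⟩ :=
    (isCompact_Icc.prod (isCompact_univ_pi fun _ => isCompact_Icc)).tendsto_subseq hmem
  have hJ : Filter.Tendsto (fun k => j (φ k)) Filter.atTop (nhds J) :=
    (continuous_fst.tendsto _).comp hlim
  have hW : Filter.Tendsto (fun k => W (φ k)) Filter.atTop (nhds W') :=
    (continuous_snd.tendsto _).comp hlim
  have hvlim : Filter.Tendsto (fun k => val (g (φ k)) (W (φ k))) Filter.atTop
      (nhds (val 1 W')) :=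
    (hval.tendsto (1, W')).comp ((hg.comp hφ.tendsto_atTop).prodMk_nhds hW)
  refine ⟨J, W', fun s => tendsto_nhds_unique (hJ.add (tendsto_pi_nhds.1 hW s)) ?_⟩
  exact (tendsto_pi_nhds.1 hvlim s).congr fun k => (heq _ s).symm

/-- Vanishing discount: `j = (1 - γ) V s₀` and `W = V - V s₀` solve `j + W = val (r + γ P W)` and
stay in a compact set by the span bound, so a limit point as `γ → 1` solves the undiscounted
optimality equation. -/
theorem exists_isValue [Nonempty S] [Nonempty A] [Nonempty B]
    {nash : (A → B → ℝ) → stdSimplex ℝ A × stdSimplex ℝ B} (hnash : ∀ M, IsMatrixNash M (nash M))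
    {D : ℝ≥0} (hD : G.diameter ≤ (D : ℝ≥0∞)) : ∃ J, G.IsValue J := by
  obtain ⟨s₀⟩ := ‹Nonempty S›
  obtain ⟨g, hg, hglim⟩ : ∃ g : ℕ → ℝ, (∀ k, 0 ≤ g k ∧ g k < 1) ∧
      Filter.Tendsto g Filter.atTop (nhds 1) := by
    refine ⟨fun k => 1 - 1 / ((k : ℝ) + 1), fun k => ⟨sub_nonneg.2 ?_,
      sub_lt_self _ (by positivity)⟩, ?_⟩
    · rw [div_le_one (by positivity)]
      linarith [k.cast_nonneg (α := ℝ)]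
    · simpa only [sub_zero] using
        (tendsto_one_div_add_atTop_nhds_zero_nat (𝕜 := ℝ)).const_sub (1 : ℝ)
  have hg0 : ∀ k, 0 ≤ g k := fun k => (hg k).1
  have hg1 : ∀ k, g k < 1 := fun k => (hg k).2
  choose V hV using fun k => exists_isDiscountedValue (G := G) hnash (hg0 k) (hg1 k)
  let val : ℝ → (S → ℝ) → S → ℝ := fun c W s =>
    mixedPayoff (nash (G.stagePayoff c W s)).1 (nash (G.stagePayoff c W s)).2 (G.stagePayoff c W s)
  have hval : Continuous fun x : ℝ × (S → ℝ) => val x.1 x.2 := by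
    refine continuous_pi fun s => (IsMatrixNash.continuous_payoff hnash).comp ?_
    refine continuous_pi fun a => continuous_pi fun b => ?_
    simp only [stagePayoff, nextValue]
    fun_prop
  let j : ℕ → ℝ := fun k => (1 - g k) * V k s₀
  let W : ℕ → S → ℝ := fun k s => V k s - V k s₀
  have heq : ∀ k s, j k + W k s = val (g k) (W k) s := by
    intro k s
    have h1 := (hnash (G.stagePayoff (g k) (V k) s)).payoff_eq_add
      (hnash (G.stagePayoff (g k) (W k) s)) (c := g k * V k s₀) fun a b => by
        have : V k = fun u => W k u + V k s₀ := by funext u; simp [W]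
        simp only [stagePayoff]
        conv_lhs => rw [this]
        rw [nextValue_add, nextValue_const]
        ring
    have h2 := (hV k s).2
    simp only [j, W, val] at h1 ⊢
    linarith
  obtain ⟨J, W', hfin⟩ := exists_optimality_of_tendsto hval hglim heq (D := D)
    (fun k => ⟨mul_nonneg (sub_nonneg.2 (hg1 k).le) ((hV k).nonneg (hg0 k) (hg1 k) s₀),
      (hV k).mul_le_one (hg0 k) (hg1 k) s₀⟩)
    (fun k s => ⟨by linarith [(hV k).le_add_diameter (hg0 k) (hg1 k) hD s s₀],
      by linarith [(hV k).le_add_diameter (hg0 k) (hg1 k) hD s₀ s]⟩)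
  have hone : ∀ s, G.stagePayoff 1 W' s = fun a b => G.r s a b + G.nextValue W' s a b := fun s => by
    funext a b
    rw [stagePayoff, one_mul]
  refine ⟨J, isValue_of_optimality J W' (fun s => nash (G.stagePayoff 1 W' s)) (fun s => ?_)
    fun s => ?_⟩
  · rw [← hone]
    exact hnash _
  · rw [← hone]
    exact hfin s

end Game

end StochasticGame

/-- **Hoeffding's lemma** for a distribution on a finite set. -/
theorem stdSimplex_sum_mul_exp_le {S : Type*} [Fintype S] (p : stdSimplex ℝ S) (X : S → ℝ)
    {c d : ℝ} (hX : ∀ s, X s ∈ Set.Icc c (c + d)) (l : ℝ) :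
    ∑ s, p s * Real.exp (l * (X s - ∑ u, p u * X u)) ≤ Real.exp (l ^ 2 * d ^ 2 / 8) := by
  let _ : MeasurableSpace S := ⊤
  have hsum : ∑ s, ENNReal.ofReal (p s) = 1 := by
    rw [← ENNReal.ofReal_sum_of_nonneg fun s _ => stdSimplex_apply_nonneg p s,
      stdSimplex_sum_eq_one, ENNReal.ofReal_one]
  let P : PMF S := PMF.ofFintype (fun s => ENNReal.ofReal (p s)) hsum
  have hint : ∀ f : S → ℝ, ∫ s, f s ∂P.toMeasure = ∑ s, p s * f s := by
    intro f
    rw [PMF.integral_eq_sum]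
    refine Finset.sum_congr rfl fun s _ => ?_
    rw [PMF.ofFintype_apply, ENNReal.toReal_ofReal (stdSimplex_apply_nonneg p s), smul_eq_mul]
  have h := (ProbabilityTheory.hasSubgaussianMGF_of_mem_Icc (μ := P.toMeasure) (X := X)
    (measurable_from_top.aemeasurable) (Filter.Eventually.of_forall hX)).mgf_le l
  rw [ProbabilityTheory.mgf, hint, hint] at h
  refine h.trans_eq ?_
  congr 1
  push_cast
  rw [add_sub_cancel_left, Real.norm_eq_abs, div_pow, sq_abs]
  ring

namespace StochasticGame

/-! ### Expectations over histories -/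

section Play

variable {S A B : Type*} [Fintype S] [Fintype A] [Fintype B] (G : StochasticGame S A B)

/-- The conditional expectation of `f` after one more round. -/
noncomputable def stepMean (σ : List (S × A × B) → S → stdSimplex ℝ A)
    (ω : List (S × A × B) → S → stdSimplex ℝ B) (f : List (S × A × B) × S → ℝ)
    (h : List (S × A × B) × S) : ℝ :=
  mixedPayoff (σ h.1 h.2) (ω h.1 h.2) fun a b =>
    G.nextValue (fun s' => f ((h.2, a, b) :: h.1, s')) h.2 a b

variable {G} {σ : List (S × A × B) → S → stdSimplex ℝ A}
  {ω : List (S × A × B) → S → stdSimplex ℝ B} {s₁ : S}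

theorem expect_succ (n : ℕ) (f : List (S × A × B) × S → ℝ) :
    G.expect σ ω s₁ (n + 1) f = G.expect σ ω s₁ n (G.stepMean σ ω f) := by
  rw [expect]
  congr 1
  funext h
  simp only [stepMean, mixedPayoff, nextValue, Finset.mul_sum]
  exact Finset.sum_congr rfl fun a _ => Finset.sum_congr rfl fun b _ =>
    Finset.sum_congr rfl fun s' _ => by ring

theorem expect_mono {n : ℕ} {f g : List (S × A × B) × S → ℝ}
    (h : ∀ x, x.1.length = n → f x ≤ g x) : G.expect σ ω s₁ n f ≤ G.expect σ ω s₁ n g := by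
  induction n generalizing f g with
  | zero => exact h _ rfl
  | succ n ih =>
    rw [expect_succ, expect_succ]
    exact ih fun x hx => mixedPayoff_mono fun a b =>
      nextValue_mono (fun s' => h _ (by simp [hx])) _ _ _

theorem expect_add (n : ℕ) (f g : List (S × A × B) × S → ℝ) :
    G.expect σ ω s₁ n (fun x => f x + g x) = G.expect σ ω s₁ n f + G.expect σ ω s₁ n g := by
  induction n generalizing f g with
  | zero => rfl
  | succ n ih =>
    rw [expect_succ, expect_succ, expect_succ, ← ih]
    congr 1
    funext x
    simp only [stepMean, nextValue_add, mixedPayoff_add]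

theorem expect_mul_left (n : ℕ) (c : ℝ) (f : List (S × A × B) × S → ℝ) :
    G.expect σ ω s₁ n (fun x => c * f x) = c * G.expect σ ω s₁ n f := by
  induction n generalizing f with
  | zero => rfl
  | succ n ih =>
    rw [expect_succ, expect_succ, ← ih]
    congr 1
    funext x
    simp only [stepMean, nextValue_mul_left, mixedPayoff_mul_left]

theorem expect_const (n : ℕ) (c : ℝ) : G.expect σ ω s₁ n (fun _ => c) = c := by
  induction n with
  | zero => rfl
  | succ n ih =>
    rw [expect_succ]
    refine Eq.trans (congrArg _ (funext fun x => ?_)) ih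
    simp only [stepMean, nextValue_const, mixedPayoff_const]

theorem expect_sum {ι : Type*} (n : ℕ) (t : Finset ι) (f : ι → List (S × A × B) × S → ℝ) :
    G.expect σ ω s₁ n (fun x => ∑ i ∈ t, f i x) = ∑ i ∈ t, G.expect σ ω s₁ n (f i) := by
  classical
  induction t using Finset.induction_on with
  | empty => simp only [Finset.sum_empty, expect_const]
  | insert i t hi ih => simp only [Finset.sum_insert hi, expect_add, ih]

/-- The expectation of a supermartingale is at most its initial value. -/
theorem expect_le_of_stepMean_le {F : List (S × A × B) × S → ℝ}
    (h : ∀ x, G.stepMean σ ω F x ≤ F x) (n : ℕ) : G.expect σ ω s₁ n F ≤ F ([], s₁) := by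
  induction n with
  | zero => exact le_rfl
  | succ n ih =>
    rw [expect_succ]
    exact (expect_mono fun x _ => h x).trans ih

end Play

end StochasticGame

namespace DonqMemory

/-! ### Learning rates and bonuses -/

theorem rate_succ_mem_Icc {H : ℝ} (hH : 0 < H) (n : ℕ) : rate H (n + 1) ∈ Set.Icc (0 : ℝ) 1 := by
  rw [rate]
  push_cast
  have hn : (0 : ℝ) ≤ n := n.cast_nonneg
  exact ⟨by positivity, (div_le_one (by positivity)).2 (by linarith)⟩

theorem rate_one {H : ℝ} (hH : 0 < H) : rate H 1 = 1 := by
  rw [rate, Nat.cast_one, div_self (by positivity)]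

theorem mul_rate_succ {H : ℝ} (hH : 0 < H) (n : ℕ) : (H + n + 1) * rate H (n + 1) = H + 1 := by
  rw [rate]
  push_cast
  rw [← add_assoc]
  field_simp

/-- The bonuses averaged with the learning rates. -/
noncomputable def averagedBonus (H : ℝ) (β : ℕ → ℝ) : ℕ → ℝ
  | 0 => 0
  | n + 1 => (1 - rate H (n + 1)) * averagedBonus H β n + rate H (n + 1) * β (n + 1)

/-- The lower end makes the bonus dominate the noise (optimism); the upper end limits what the bonus
costs in regret. -/
theorem averagedBonus_mem_Icc {H : ℝ} (hH : 0 < H) {β : ℕ → ℝ} {k : ℝ} (hk : 0 ≤ k)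
    (hβ : ∀ n, β n = k / √n) (n : ℕ) :
    averagedBonus H β (n + 1) ∈ Set.Icc (β (n + 1)) (2 * β (n + 1)) := by
  induction n with
  | zero =>
    simp only [averagedBonus, zero_add, rate_one hH, sub_self, zero_mul, one_mul]
    have : 0 ≤ β 1 := by rw [hβ]; positivity
    exact ⟨le_rfl, by linarith⟩
  | succ n ih =>
    rw [averagedBonus]
    obtain ⟨h0, h1⟩ := rate_succ_mem_Icc hH (n + 1)
    have hr := mul_rate_succ hH (n + 1)
    set α := rate H (n + 1 + 1)
    have ha : (0 : ℝ) < √((n + 1 : ℕ) : ℝ) := Real.sqrt_pos.2 (by positivity)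
    have hb : (0 : ℝ) < √((n + 1 + 1 : ℕ) : ℝ) := Real.sqrt_pos.2 (by positivity)
    have ha2 : √((n + 1 : ℕ) : ℝ) ^ 2 = (n + 1 : ℕ) := Real.sq_sqrt (by positivity)
    have hb2 : √((n + 1 + 1 : ℕ) : ℝ) ^ 2 = (n + 1 : ℕ) + 1 := by
      rw [Real.sq_sqrt (by positivity)]; push_cast; ring
    rw [hβ (n + 1)] at ih
    rw [hβ (n + 1 + 1)]
    have hab : √((n + 1 : ℕ) : ℝ) ≤ √((n + 1 + 1 : ℕ) : ℝ) :=
      Real.sqrt_le_sqrt (by push_cast; linarith)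
    generalize √((n + 1 : ℕ) : ℝ) = x at *
    generalize √((n + 1 + 1 : ℕ) : ℝ) = y at *
    rw [← ha2] at hr hb2
    constructor
    · have h2 : k / y ≤ k / x := div_le_div_of_nonneg_left hk ha hab
      nlinarith [mul_le_mul_of_nonneg_left (h2.trans ih.1) (sub_nonneg.2 h1)]
    · have h3 : (1 - α) * averagedBonus H β (n + 1) ≤ (1 - α) * (2 * (k / x)) :=
        mul_le_mul_of_nonneg_left ih.2 (sub_nonneg.2 h1)
      have h4 : (1 - α) * (2 * (k / x)) + α * (k / y) ≤ 2 * (k / y) := by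
        -- Here `y² = x² + 1`; after clearing the rate the claim reduces to `2xy ≤ x² + y²`.
        have h5 : (H + x ^ 2 + 1) * ((1 - α) * (2 / x) + α / y) ≤ (H + x ^ 2 + 1) * (2 / y) := by
          have e1 : (H + x ^ 2 + 1) * ((1 - α) * (2 / x) + α / y) = 2 * x + (H + 1) / y := by
            have : (H + x ^ 2 + 1) * (1 - α) = x ^ 2 := by linarith
            calc _ = ((H + x ^ 2 + 1) * (1 - α)) * (2 / x) + ((H + x ^ 2 + 1) * α) / y := by ring
              _ = 2 * x + (H + 1) / y := by rw [this, hr]; field_simp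
          rw [e1, ← mul_div_assoc, ← sub_nonneg]
          have : (H + x ^ 2 + 1) * 2 / y - (2 * x + (H + 1) / y) =
              (H + 2 * x ^ 2 + 1 - 2 * x * y) / y := by field_simp; ring
          rw [this]
          refine div_nonneg ?_ hb.le
          nlinarith [sq_nonneg (x - y)]
        have h6 := le_of_mul_le_mul_left h5 (by positivity)
        have := mul_le_mul_of_nonneg_left h6 hk
        calc _ = k * ((1 - α) * (2 / x) + α / y) := by ring
          _ ≤ k * (2 / y) := this
          _ = _ := by ring
      linarith

theorem bonus_eq_div (D H δ : ℝ) (T : ℕ) (hL : 0 ≤ H * Real.log (2 * T / δ)) (n : ℕ) :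
    bonus D H δ T n = 2 * D * √(H * Real.log (2 * T / δ)) / √n := by
  rw [bonus, Real.sqrt_div hL, mul_div_assoc (2 * D)]

/-! ### Consistent memories -/

section Consistent

variable {S A B : Type*} [Fintype A] [Fintype B]

/-- The value estimator and the policy of the memory come from Nash equilibria. -/
def Consistent (m : DonqMemory S A B) : Prop :=
  ∀ s, ∃ p, IsMatrixNash (m.Qd s) p ∧ m.V s = mixedPayoff p.1 p.2 (m.Qd s) ∧ m.μ s = p.1

theorem consistent_init [Nonempty A] [Nonempty B] (H : ℝ) : (init S A B H).Consistent := by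
  refine fun s => ⟨(stdSimplex.barycenter, stdSimplex.barycenter),
    ⟨fun x => ?_, fun y => ?_⟩, ?_, rfl⟩
  · exact ((mixedPayoff_const H).trans (mixedPayoff_const H).symm).le
  · exact ((mixedPayoff_const H).trans (mixedPayoff_const H).symm).le
  · exact (mixedPayoff_const H).symm

theorem Consistent.update {m : DonqMemory S A B} (hm : m.Consistent) {D H δ : ℝ} {T : ℕ}
    {nash : (A → B → ℝ) → stdSimplex ℝ A × stdSimplex ℝ B} (hnash : ∀ M, IsMatrixNash M (nash M))
    (s : S) (a : A) (b : B) (ρ : ℝ) (s' : S) :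
    (m.update D H δ T nash s a b ρ s').Consistent := by
  intro u
  by_cases h : u = s
  · subst h
    exact ⟨_, hnash _, by simp only [DonqMemory.update, if_true], by
      simp only [DonqMemory.update, if_true]⟩
  · obtain ⟨p, h1, h2, h3⟩ := hm u
    have : (m.update D H δ T nash s a b ρ s').Qd u = m.Qd u := by
      funext x y
      simp only [DonqMemory.update, h, false_and, if_false]
    refine ⟨p, by rwa [this], ?_, ?_⟩
    · rw [this, ← h2]
      simp only [DonqMemory.update, h, if_false]
    · rw [← h3]
      simp only [DonqMemory.update, h, if_false]

variable {m m' : DonqMemory S A B}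

theorem Consistent.V_mono (hm : m.Consistent) (hm' : m'.Consistent)
    (h : ∀ s a b, m.Qd s a b ≤ m'.Qd s a b) (s : S) : m.V s ≤ m'.V s := by
  obtain ⟨p, h1, h2, -⟩ := hm s
  obtain ⟨q, h3, h4, -⟩ := hm' s
  rw [h2, h4]
  exact h1.payoff_mono h3 (h s)

theorem Consistent.le_V (hm : m.Consistent) {s : S} {M : A → B → ℝ}
    {p : stdSimplex ℝ A × stdSimplex ℝ B} (hp : IsMatrixNash M p)
    (h : ∀ a b, M a b ≤ m.Qd s a b) : mixedPayoff p.1 p.2 M ≤ m.V s := by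
  obtain ⟨q, h1, h2, -⟩ := hm s
  rw [h2]
  exact hp.payoff_mono h1 h

theorem Consistent.V_nonneg (hm : m.Consistent) {s : S} (h : ∀ a b, 0 ≤ m.Qd s a b) :
    0 ≤ m.V s := by
  obtain ⟨q, h1, h2, -⟩ := hm s
  rw [h2, ← mixedPayoff_const (x := q.1) (y := q.2) 0]
  exact mixedPayoff_mono h

/-- This is what makes an arbitrary opponent harmless: the learner's policy is a maximin strategy of
the estimated matrix game. -/
theorem Consistent.V_le_mixedPayoff (hm : m.Consistent) (s : S) (y : stdSimplex ℝ B) :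
    m.V s ≤ mixedPayoff (m.μ s) y (m.Qd s) := by
  obtain ⟨q, h1, h2, h3⟩ := hm s
  rw [h2, h3]
  exact h1.2 y

theorem update_Qd_le {D H δ : ℝ} {T : ℕ} {nash : (A → B → ℝ) → stdSimplex ℝ A × stdSimplex ℝ B}
    (s : S) (a : A) (b : B) (ρ : ℝ) (s' : S) (x : S) (y : A) (z : B) :
    (m.update D H δ T nash s a b ρ s').Qd x y z ≤ m.Qd x y z := by
  simp only [DonqMemory.update]
  split_ifs with h
  · obtain ⟨rfl, rfl, rfl⟩ := h
    exact min_le_left _ _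
  · exact le_rfl

end Consistent

end DonqMemory

/-! ### Averages along a history -/

section History

variable {S A B : Type*}

open Classical in
/-- The average, with the learning rates as weights, of the observations `X` made in the rounds in
which `y` was played. -/
noncomputable def filtered (H : ℝ) (X : List (S × A × B) → S × A × B → S → ℝ) :
    List (S × A × B) → S → S × A × B → ℝ
  | [], _, _ => 0
  | x :: past, s', y =>
      if y = x then
        (1 - DonqMemory.rate H (past.count x + 1)) * filtered H X past x.1 x +
          DonqMemory.rate H (past.count x + 1) * X past x s'
      else filtered H X past x.1 y

/-- The sum of the observations `f` over all rounds. -/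
def sumRounds (f : List (S × A × B) → S × A × B → S → ℝ) : List (S × A × B) → S → ℝ
  | [], _ => 0
  | x :: past, s' => sumRounds f past x.1 + f past x s'

variable {H : ℝ} {X : List (S × A × B) → S × A × B → S → ℝ}

open Classical in
theorem filtered_cons_self (x : S × A × B) (past : List (S × A × B)) (s' : S) :
    filtered H X (x :: past) s' x =
      (1 - DonqMemory.rate H (past.count x + 1)) * filtered H X past x.1 x +
        DonqMemory.rate H (past.count x + 1) * X past x s' := by
  simp only [filtered, if_true]

theorem filtered_cons_of_ne {x y : S × A × B} (h : y ≠ x) (past : List (S × A × B)) (s' : S) :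
    filtered H X (x :: past) s' y = filtered H X past x.1 y := by
  simp only [filtered, h, if_false]

open Classical in
theorem sum_count_eq_length [Fintype S] [Fintype A] [Fintype B] (h : List (S × A × B)) :
    ∑ x, h.count x = h.length := by
  induction h with
  | nil => simp
  | cons y h ih =>
    simp only [List.count_cons, Finset.sum_add_distrib, ih, List.length_cons, beq_iff_eq,
      Finset.sum_ite_eq, Finset.mem_univ, if_true]

end History

namespace DonqMemory

variable {S A B : Type*} [Fintype A] [Fintype B] {D H δ : ℝ} {T : ℕ}
  {nash : (A → B → ℝ) → stdSimplex ℝ A × stdSimplex ℝ B}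

theorem update_Q_self (m : DonqMemory S A B) (s : S) (a : A) (b : B) (ρ : ℝ) (s' : S) :
    (m.update D H δ T nash s a b ρ s').Q s a b =
      (1 - rate H (m.N s a b + 1)) * m.Q s a b +
        rate H (m.N s a b + 1) * (ρ + (1 - 1 / H) * m.V s' + bonus D H δ T (m.N s a b + 1)) := by
  simp only [update, and_self, if_true]

theorem update_Q_of_ne (m : DonqMemory S A B) {x y : S × A × B} (h : y ≠ x) (ρ : ℝ) (s' : S) :
    (m.update D H δ T nash x.1 x.2.1 x.2.2 ρ s').Q y.1 y.2.1 y.2.2 = m.Q y.1 y.2.1 y.2.2 := by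
  have : ¬(y.1 = x.1 ∧ y.2.1 = x.2.1 ∧ y.2.2 = x.2.2) := fun h' =>
    h (Prod.ext h'.1 (Prod.ext h'.2.1 h'.2.2))
  simp only [update, this, if_false]

theorem update_Qd_self (m : DonqMemory S A B) (s : S) (a : A) (b : B) (ρ : ℝ) (s' : S) :
    (m.update D H δ T nash s a b ρ s').Qd s a b =
      min (m.Qd s a b) ((m.update D H δ T nash s a b ρ s').Q s a b) := by
  simp only [update, and_self, if_true]

theorem update_Qd_of_ne (m : DonqMemory S A B) {x y : S × A × B} (h : y ≠ x) (ρ : ℝ) (s' : S) :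
    (m.update D H δ T nash x.1 x.2.1 x.2.2 ρ s').Qd y.1 y.2.1 y.2.2 = m.Qd y.1 y.2.1 y.2.2 := by
  have : ¬(y.1 = x.1 ∧ y.2.1 = x.2.1 ∧ y.2.2 = x.2.2) := fun h' =>
    h (Prod.ext h'.1 (Prod.ext h'.2.1 h'.2.2))
  simp only [update, this, if_false]

theorem bonus_nonneg (hD : 0 ≤ D) (n : ℕ) : 0 ≤ bonus D H δ T n := by
  rw [bonus]
  positivity

end DonqMemory

/-! ### Optimism of the estimators on concentrated histories -/

namespace StochasticGame

section Deviation

variable {S A B : Type*} [Fintype S] (G : StochasticGame S A B)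

/-- The deviation of `V` in the next state from its expectation. -/
noncomputable def deviation (V : S → ℝ) (_ : List (S × A × B)) (x : S × A × B) (s' : S) : ℝ :=
  V s' - G.nextValue V x.1 x.2.1 x.2.2

open Classical in
/-- At every visit of a triple, the averaged deviations are bounded by the bonus. -/
def Concentrated (D H δ : ℝ) (T : ℕ) (V : S → ℝ) : List (S × A × B) → S → Prop
  | [], _ => True
  | x :: past, s' => Concentrated D H δ T V past x.1 ∧
      |filtered H (G.deviation V) (x :: past) s' x| ≤
        DonqMemory.bonus D H δ T ((x :: past).count x)

variable {G} {D H δ : ℝ} {T : ℕ} {V : S → ℝ}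

open Classical in
-- Neither the average nor the count of `y` changes between visits, so the bound recorded at the
-- last visit persists.
theorem Concentrated.abs_filtered_le {h : List (S × A × B)} {s : S}
    (hc : G.Concentrated D H δ T V h s) {y : S × A × B} (hy : 0 < h.count y) :
    |filtered H (G.deviation V) h s y| ≤ DonqMemory.bonus D H δ T (h.count y) := by
  induction h generalizing s with
  | nil => simp at hy
  | cons x past ih =>
    by_cases hxy : y = x
    · subst hxy
      exact hc.2
    · rw [List.count_cons_of_ne (Ne.symm hxy)] at hy ⊢
      rw [filtered_cons_of_ne hxy]
      exact ih hc.1 hy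

end Deviation

section Learning

variable {S A B : Type*} [Fintype S] [Fintype A] [Fintype B] [Nonempty A]
  (G : StochasticGame S A B) (D H δ : ℝ) (T : ℕ)
  (nash : (A → B → ℝ) → stdSimplex ℝ A × stdSimplex ℝ B) (V : S → ℝ)

/-- The excess of the value estimator in the next state. -/
noncomputable def excess (past : List (S × A × B)) (x : S × A × B) (s' : S) : ℝ :=
  (G.donqMemory D H δ T nash past x.1).V s' - V s'

variable {G D H δ T nash V}

theorem donqMemory_cons (x : S × A × B) (past : List (S × A × B)) (s' : S) :
    G.donqMemory D H δ T nash (x :: past) s' =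
      (G.donqMemory D H δ T nash past x.1).update D H δ T nash x.1 x.2.1 x.2.2
        (G.r x.1 x.2.1 x.2.2) s' := rfl

open Classical in
theorem donqMemory_N (h : List (S × A × B)) (s : S) (y : S × A × B) :
    (G.donqMemory D H δ T nash h s).N y.1 y.2.1 y.2.2 = h.count y := by
  induction h generalizing s with
  | nil => simp [donqMemory, DonqMemory.init]
  | cons x past ih =>
    rw [donqMemory_cons]
    by_cases hxy : y = x
    · subst hxy
      simp only [DonqMemory.update, and_self, if_true, List.count_cons_self, ih]
    · have : ¬(y.1 = x.1 ∧ y.2.1 = x.2.1 ∧ y.2.2 = x.2.2) := fun h' =>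
        hxy (Prod.ext h'.1 (Prod.ext h'.2.1 h'.2.2))
      simp only [DonqMemory.update, this, if_false, ih, List.count_cons_of_ne (Ne.symm hxy)]

theorem donqMemory_consistent [Nonempty B] (hnash : ∀ M, IsMatrixNash M (nash M))
    (h : List (S × A × B)) (s : S) : (G.donqMemory D H δ T nash h s).Consistent := by
  induction h generalizing s with
  | nil => exact DonqMemory.consistent_init H
  | cons x past ih => exact (ih x.1).update hnash _ _ _ _ _

theorem donqMemory_Qd_le (x : S × A × B) (past : List (S × A × B)) (s' : S) (u : S) (a : A)
    (b : B) : (G.donqMemory D H δ T nash (x :: past) s').Qd u a b ≤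
      (G.donqMemory D H δ T nash past x.1).Qd u a b :=
  DonqMemory.update_Qd_le _ _ _ _ _ _ _ _

theorem donqMemory_Qd_le_horizon (h : List (S × A × B)) (s u : S) (a : A) (b : B) :
    (G.donqMemory D H δ T nash h s).Qd u a b ≤ H := by
  induction h generalizing s with
  | nil => exact le_rfl
  | cons x past ih => exact (donqMemory_Qd_le x past s u a b).trans (ih x.1)

theorem donqMemory_Qd_le_Q (h : List (S × A × B)) (s : S) (y : S × A × B) :
    (G.donqMemory D H δ T nash h s).Qd y.1 y.2.1 y.2.2 ≤
      (G.donqMemory D H δ T nash h s).Q y.1 y.2.1 y.2.2 := by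
  induction h generalizing s with
  | nil => exact le_rfl
  | cons x past ih =>
    rw [donqMemory_cons]
    by_cases hxy : y = x
    · subst hxy
      rw [DonqMemory.update_Qd_self]
      exact min_le_right _ _
    · rw [DonqMemory.update_Q_of_ne _ hxy, DonqMemory.update_Qd_of_ne _ hxy]
      exact ih x.1

theorem donqMemory_nonneg [Nonempty B] (hnash : ∀ M, IsMatrixNash M (nash M)) (hD : 0 ≤ D)
    (hH : 1 < H) (h : List (S × A × B)) (s : S) (y : S × A × B) :
    0 ≤ (G.donqMemory D H δ T nash h s).Q y.1 y.2.1 y.2.2 ∧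
      0 ≤ (G.donqMemory D H δ T nash h s).Qd y.1 y.2.1 y.2.2 := by
  induction h generalizing s y with
  | nil => exact ⟨(zero_le_one.trans hH.le : (0 : ℝ) ≤ H), (zero_le_one.trans hH.le : (0 : ℝ) ≤ H)⟩
  | cons x past ih =>
    rw [donqMemory_cons]
    by_cases hxy : y = x
    · subst hxy
      rw [DonqMemory.update_Qd_self, le_min_iff, DonqMemory.update_Q_self]
      suffices hQ : 0 ≤ (1 - DonqMemory.rate H ((G.donqMemory D H δ T nash past y.1).N y.1 y.2.1
          y.2.2 + 1)) * (G.donqMemory D H δ T nash past y.1).Q y.1 y.2.1 y.2.2 +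
          DonqMemory.rate H ((G.donqMemory D H δ T nash past y.1).N y.1 y.2.1 y.2.2 + 1) *
            (G.r y.1 y.2.1 y.2.2 + (1 - 1 / H) * (G.donqMemory D H δ T nash past y.1).V s +
              DonqMemory.bonus D H δ T ((G.donqMemory D H δ T nash past y.1).N y.1 y.2.1
                y.2.2 + 1)) from ⟨hQ, (ih y.1 y).2, hQ⟩
      obtain ⟨h0, h1⟩ := DonqMemory.rate_succ_mem_Icc (zero_lt_one.trans hH)
        ((G.donqMemory D H δ T nash past y.1).N y.1 y.2.1 y.2.2)
      have hγ : 0 ≤ 1 - 1 / H := sub_nonneg.2 ((div_le_one (zero_lt_one.trans hH)).2 hH.le)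
      have hVn := (donqMemory_consistent (G := G) (D := D) (H := H) (δ := δ) (T := T) hnash
        past y.1).V_nonneg (s := s) fun a b => (ih y.1 (s, a, b)).2
      exact add_nonneg (mul_nonneg (sub_nonneg.2 h1) (ih y.1 y).1) (mul_nonneg h0
        (add_nonneg (add_nonneg (G.r_mem _ _ _).1 (mul_nonneg hγ hVn))
          (DonqMemory.bonus_nonneg hD _)))
    · rw [DonqMemory.update_Q_of_ne _ hxy, DonqMemory.update_Qd_of_ne _ hxy]
      exact ih x.1 y

open Classical in
/-- The optimistic estimator in terms of the averages of the excess, the deviation, the bonus. -/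
theorem donqMemory_Q_eq (hH : 0 < H) (h : List (S × A × B)) (s : S) (y : S × A × B)
    (hy : 0 < h.count y) :
    (G.donqMemory D H δ T nash h s).Q y.1 y.2.1 y.2.2 =
      G.stagePayoff (1 - 1 / H) V y.1 y.2.1 y.2.2 +
        (1 - 1 / H) * (filtered H (G.excess D H δ T nash V) h s y +
          filtered H (G.deviation V) h s y) +
        DonqMemory.averagedBonus H (DonqMemory.bonus D H δ T) (h.count y) := by
  induction h generalizing s with
  | nil => simp at hy
  | cons x past ih =>
    rw [donqMemory_cons]
    by_cases hxy : y = x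
    · subst hxy
      rw [DonqMemory.update_Q_self, filtered_cons_self, filtered_cons_self, List.count_cons_self,
        DonqMemory.averagedBonus, donqMemory_N]
      simp only [excess, deviation, stagePayoff] at ih ⊢
      rcases Nat.eq_zero_or_pos (past.count y) with h0 | h0
      -- The first rate is `1`, so the initial value `H` is forgotten at the first visit.
      · rw [h0, zero_add, DonqMemory.rate_one hH]
        ring
      · rw [ih y.1 h0]
        ring
    · rw [List.count_cons_of_ne (Ne.symm hxy)] at hy ⊢
      rw [DonqMemory.update_Q_of_ne _ hxy, filtered_cons_of_ne hxy, filtered_cons_of_ne hxy]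
      exact ih x.1 hy

/-- Optimism of the estimators on concentrated histories. -/
theorem Concentrated.optimism [Nonempty B] (hnash : ∀ M, IsMatrixNash M (nash M))
    {p : S → stdSimplex ℝ A × stdSimplex ℝ B} (hV : G.IsDiscountedValue (1 - 1 / H) V p)
    (hD : 0 ≤ D) (hH : 1 < H) (hL : 0 ≤ Real.log (2 * T / δ)) {h : List (S × A × B)} {s : S}
    (hc : G.Concentrated D H δ T V h s) :
    (∀ y, 0 ≤ filtered H (G.excess D H δ T nash V) h s y) ∧
    (∀ y : S × A × B, G.stagePayoff (1 - 1 / H) V y.1 y.2.1 y.2.2 ≤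
      (G.donqMemory D H δ T nash h s).Qd y.1 y.2.1 y.2.2) ∧
    ∀ u, V u ≤ (G.donqMemory D H δ T nash h s).V u := by
  have hH0 : 0 < H := zero_lt_one.trans hH
  have hγ0 : 0 ≤ 1 - 1 / H := sub_nonneg.2 ((div_le_one hH0).2 hH.le)
  have hγ1 : 1 - 1 / H < 1 := sub_lt_self _ (by positivity)
  have hVle := hV.le_horizon hH
  have hVopt : ∀ (h : List (S × A × B)) (s : S),
      (∀ y : S × A × B, G.stagePayoff (1 - 1 / H) V y.1 y.2.1 y.2.2 ≤
        (G.donqMemory D H δ T nash h s).Qd y.1 y.2.1 y.2.2) →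
      ∀ u, V u ≤ (G.donqMemory D H δ T nash h s).V u := fun h s hq u =>
    (hV u).2.trans_le ((donqMemory_consistent hnash h s).le_V (hV u).1 fun a b => hq (u, a, b))
  induction h generalizing s with
  | nil =>
    have hq : ∀ y : S × A × B, G.stagePayoff (1 - 1 / H) V y.1 y.2.1 y.2.2 ≤
        (G.donqMemory D H δ T nash [] s).Qd y.1 y.2.1 y.2.2 := by
      intro y
      change _ ≤ H
      have h1 := mul_le_mul_of_nonneg_left (nextValue_le (G := G) hVle y.1 y.2.1 y.2.2) hγ0
      have h2 : (1 - 1 / H) * H = H - 1 := by field_simp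
      rw [stagePayoff]
      linarith [(G.r_mem y.1 y.2.1 y.2.2).2]
    exact ⟨fun y => le_rfl, hq, hVopt _ _ hq⟩
  | cons x past ih =>
    obtain ⟨h1, h2, h3⟩ := ih hc.1
    have hy : ∀ y, 0 ≤ filtered H (G.excess D H δ T nash V) (x :: past) s y := by
      intro y
      by_cases hxy : y = x
      · subst hxy
        classical
        rw [filtered_cons_self]
        obtain ⟨r0, r1⟩ := DonqMemory.rate_succ_mem_Icc hH0 (past.count y)
        exact add_nonneg (mul_nonneg (sub_nonneg.2 r1) (h1 y))
          (mul_nonneg r0 (sub_nonneg.2 (h3 s)))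
      · rw [filtered_cons_of_ne hxy]
        exact h1 y
    have hq : ∀ y : S × A × B, G.stagePayoff (1 - 1 / H) V y.1 y.2.1 y.2.2 ≤
        (G.donqMemory D H δ T nash (x :: past) s).Qd y.1 y.2.1 y.2.2 := by
      intro y
      by_cases hxy : y = x
      · subst hxy
        classical
        have hpos : 0 < (y :: past).count y := by rw [List.count_cons_self]; positivity
        have hQ := donqMemory_Q_eq (G := G) (D := D) (δ := δ) (T := T) (nash := nash) (V := V) hH0
          (y :: past) s y hpos
        have hb := (DonqMemory.averagedBonus_mem_Icc hH0
          (k := 2 * D * √(H * Real.log (2 * T / δ))) (by positivity)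
          (DonqMemory.bonus_eq_div D H δ T (mul_nonneg hH0.le hL)) (past.count y)).1
        have hd := (abs_le.1 (hc.abs_filtered_le hpos)).1
        rw [List.count_cons_self] at hd hQ
        have hbn := DonqMemory.bonus_nonneg (H := H) (δ := δ) (T := T) hD (past.count y + 1)
        rw [donqMemory_cons, DonqMemory.update_Qd_self, ← donqMemory_cons, hQ]
        refine le_min (h2 y) ?_
        -- The averaged excess is nonnegative by induction, and the averaged bonus, being at least
        -- the bonus, absorbs the worst deviation.
        have e1 := mul_nonneg hγ0 (hy y)
        have e2 := mul_le_mul_of_nonneg_left hd hγ0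
        have e3 := mul_le_mul_of_nonneg_right hγ1.le hbn
        linarith
      · rw [donqMemory_cons, DonqMemory.update_Qd_of_ne _ hxy]
        exact h2 y
    exact ⟨hy, hq, hVopt _ _ hq⟩

end Learning

end StochasticGame

/-! ### Regret along a concentrated history -/

theorem one_div_sqrt_le (n : ℕ) :
    1 / √((n + 1 : ℕ) : ℝ) ≤ 2 * √((n + 1 : ℕ) : ℝ) - 2 * √(n : ℝ) := by
  have h1 : √((n + 1 : ℕ) : ℝ) ^ 2 = n + 1 := by rw [Real.sq_sqrt (by positivity)]; push_cast; rfl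
  have h2 : √(n : ℝ) ^ 2 = n := Real.sq_sqrt (by positivity)
  have h3 : 0 < √((n + 1 : ℕ) : ℝ) := Real.sqrt_pos.2 (by positivity)
  rw [div_le_iff₀ h3]
  nlinarith [sq_nonneg (√((n + 1 : ℕ) : ℝ) - √(n : ℝ))]

namespace StochasticGame

theorem regret_le_length {S A B : Type*} [Fintype S] {G : StochasticGame S A B} {J : ℝ}
    (hJ : J ≤ 1) (h : List (S × A × B)) : G.regret J h ≤ h.length := by
  induction h with
  | nil => simp [regret]
  | cons x past ih =>
    have : G.regret J (x :: past) = J - G.r x.1 x.2.1 x.2.2 + G.regret J past := by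
      simp only [regret, List.map_cons, List.sum_cons]
    rw [this, List.length_cons]
    push_cast
    linarith [(G.r_mem x.1 x.2.1 x.2.2).1]

section Regret

variable {S A B : Type*} [Fintype S] [Fintype A] [Fintype B] [Nonempty A]
  (G : StochasticGame S A B) (D H δ : ℝ) (T : ℕ)
  (nash : (A → B → ℝ) → stdSimplex ℝ A × stdSimplex ℝ B) (V : S → ℝ)

/-- The part of the regret of one round whose conditional expectation is nonnegative. -/
noncomputable def surplus (past : List (S × A × B)) (x : S × A × B) (s' : S) : ℝ :=
  (G.donqMemory D H δ T nash past x.1).Qd x.1 x.2.1 x.2.2 -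
    (G.donqMemory D H δ T nash past x.1).V x.1 + (1 - 1 / H) * G.deviation V past x s'

open Classical in
/-- The potential that bounds the regret incurred in the rounds in which `y` was played. -/
noncomputable def potential (h : List (S × A × B)) (s : S) (y : S × A × B) : ℝ :=
  (if h.count y = 0 then 0 else H) +
    6 * D * √(H * Real.log (2 * T / δ)) * (2 * √((h.count y - 1 : ℕ) : ℝ)) -
    (1 - 1 / H) * ((1 + h.count y / H) * filtered H (G.excess D H δ T nash V) h s y)

variable {G D H δ T nash V}

/-- The three parts of `potential` pay for the first visit, for the bonuses, and for the averaged
excess. The estimate used at a visit rests only on the earlier visits, whence `count - 1` under the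
root (truncated to `0` before the first visit). -/
theorem Concentrated.le_potential_sub [Nonempty B] (hnash : ∀ M, IsMatrixNash M (nash M))
    {p : S → stdSimplex ℝ A × stdSimplex ℝ B} (hV : G.IsDiscountedValue (1 - 1 / H) V p)
    (hD : 0 ≤ D) (hH : 1 < H) (hL : 0 ≤ Real.log (2 * T / δ)) {x : S × A × B}
    {past : List (S × A × B)} (hc : G.Concentrated D H δ T V past x.1) (s' : S) :
    (G.donqMemory D H δ T nash past x.1).Qd x.1 x.2.1 x.2.2 -
        G.stagePayoff (1 - 1 / H) V x.1 x.2.1 x.2.2 - G.excess D H δ T nash V past x s' ≤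
      G.potential D H δ T nash V (x :: past) s' x - G.potential D H δ T nash V past x.1 x := by
  classical
  have hH0 : 0 < H := zero_lt_one.trans hH
  have hγ0 : 0 ≤ 1 - 1 / H := sub_nonneg.2 ((div_le_one hH0).2 hH.le)
  have hγ1 : 1 - 1 / H < 1 := sub_lt_self _ (by positivity)
  obtain ⟨hy, -, hVV⟩ := hc.optimism hnash hV hD hH hL
  have hexc : 0 ≤ G.excess D H δ T nash V past x s' := sub_nonneg.2 (hVV s')
  have hyx := hy x
  have hstage : 0 ≤ G.stagePayoff (1 - 1 / H) V x.1 x.2.1 x.2.2 :=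
    add_nonneg (G.r_mem _ _ _).1 (mul_nonneg hγ0
      (le_nextValue (fun u => hV.nonneg hγ0 hγ1 u) _ _ _))
  have hQH := donqMemory_Qd_le_horizon (G := G) (D := D) (H := H) (δ := δ) (T := T) (nash := nash)
    past x.1 x.1 x.2.1 x.2.2
  have hQQ := donqMemory_Qd_le_Q (G := G) (D := D) (H := H) (δ := δ) (T := T) (nash := nash)
    past x.1 x
  have hmain : (1 - 1 / H) * ((1 + ((past.count x + 1 : ℕ) : ℝ) / H) *
      ((1 - DonqMemory.rate H (past.count x + 1)) *
        filtered H (G.excess D H δ T nash V) past x.1 x +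
      DonqMemory.rate H (past.count x + 1) * G.excess D H δ T nash V past x s')) -
      (1 - 1 / H) * ((1 + (past.count x : ℝ) / H) *
        filtered H (G.excess D H δ T nash V) past x.1 x) ≤
      G.excess D H δ T nash V past x s' -
        (1 - 1 / H) * filtered H (G.excess D H δ T nash V) past x.1 x := by
    have hr := DonqMemory.mul_rate_succ hH0 (past.count x)
    -- The factor `1 + n/H` in the potential is chosen so that a new observation enters with the
    -- constant weight `1 + 1/H`, while the old average loses exactly one unit.
    have hr' : (1 + ((past.count x + 1 : ℕ) : ℝ) / H) * DonqMemory.rate H (past.count x + 1) =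
        1 + 1 / H := by
      push_cast
      field_simp
      linarith
    generalize filtered H (G.excess D H δ T nash V) past x.1 x = z at *
    generalize G.excess D H δ T nash V past x s' = Y at *
    have e : (1 + ((past.count x + 1 : ℕ) : ℝ) / H) *
        ((1 - DonqMemory.rate H (past.count x + 1)) * z +
          DonqMemory.rate H (past.count x + 1) * Y) =
        (1 + ((past.count x + 1 : ℕ) : ℝ) / H) * z - (1 + 1 / H) * z + (1 + 1 / H) * Y := by
      rw [← hr']
      ring
    rw [e]
    -- Discounting compensates the amplification: `γ (1 + 1/H) = 1 - 1/H² ≤ 1`.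
    have e2 : (1 - 1 / H) * (1 + 1 / H) * Y ≤ 1 * Y := by
      refine mul_le_mul_of_nonneg_right ?_ hexc
      nlinarith [sq_nonneg (1 / H)]
    push_cast
    have e3 : ((past.count x : ℝ) + 1) / H = past.count x / H + 1 / H := add_div _ _ _
    rw [e3]
    linarith
  simp only [potential, filtered_cons_self, List.count_cons_self, Nat.add_sub_cancel,
    Nat.succ_ne_zero, if_false]
  have hz := mul_nonneg hγ0 hyx
  rcases Nat.eq_zero_or_pos (past.count x) with h0 | h0
  -- First visit: nothing has been learned, and the charge `H` covers `Q↓ ≤ H`.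
  · rw [h0] at hmain ⊢
    simp only [if_true, Nat.zero_sub, Nat.cast_zero, Real.sqrt_zero, mul_zero, add_zero] at hmain ⊢
    linarith
  · have hQ := donqMemory_Q_eq (G := G) (D := D) (δ := δ) (T := T) (nash := nash) (V := V) hH0
      past x.1 x h0
    have hd := (abs_le.1 (hc.abs_filtered_le h0)).2
    obtain ⟨n, hn⟩ := Nat.exists_eq_succ_of_ne_zero h0.ne'
    rw [Nat.succ_eq_add_one] at hn
    have hbeq := DonqMemory.bonus_eq_div D H δ T (mul_nonneg hH0.le hL)
    have hb := (DonqMemory.averagedBonus_mem_Icc hH0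
      (k := 2 * D * √(H * Real.log (2 * T / δ))) (by positivity) hbeq n).2
    have hbn := DonqMemory.bonus_nonneg (H := H) (δ := δ) (T := T) hD (n + 1)
    rw [hn] at hQ hd hmain ⊢
    simp only [Nat.add_sub_cancel, Nat.succ_ne_zero, if_false]
    have e1 := mul_le_mul_of_nonneg_left hd hγ0
    have e2 := mul_le_mul_of_nonneg_right hγ1.le hbn
    -- Two bonuses come from the averaged bonus and one from the deviation; the sum of `1/√n`
    -- telescopes into `2√n`.
    have e3 : 3 * DonqMemory.bonus D H δ T (n + 1) ≤ 6 * D * √(H * Real.log (2 * T / δ)) *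
        (2 * √((n + 1 : ℕ) : ℝ) - 2 * √(n : ℝ)) := by
      have := mul_le_mul_of_nonneg_left (one_div_sqrt_le n)
        (a := 6 * D * √(H * Real.log (2 * T / δ))) (by positivity)
      rw [hbeq]
      refine le_trans (le_of_eq ?_) this
      ring
    linarith

theorem potential_cons_of_ne {x y : S × A × B} (h : y ≠ x) (past : List (S × A × B)) (s' : S) :
    G.potential D H δ T nash V (x :: past) s' y = G.potential D H δ T nash V past x.1 y := by
  classical
  simp only [potential, filtered_cons_of_ne h, List.count_cons_of_ne (Ne.symm h)]

/-- The last summand starts at `0`, as all value estimators start at `H`, and handles `V↓_t(s_{t+1})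
- V↓_t(s_t)`: the estimators never increase, so changing time at the state `s_{t+1}` costs at most
the total decrease over all states. -/
theorem Concentrated.regret_le [Nonempty B] (hnash : ∀ M, IsMatrixNash M (nash M))
    {p : S → stdSimplex ℝ A × stdSimplex ℝ B} (hV : G.IsDiscountedValue (1 - 1 / H) V p)
    (hD : 0 ≤ D) (hH : 1 < H) (hL : 0 ≤ Real.log (2 * T / δ)) {J : ℝ}
    (hJ : ∀ s, J ≤ 1 / H * (V s + D)) {h : List (S × A × B)} {s : S}
    (hc : G.Concentrated D H δ T V h s) :
    G.regret J h + sumRounds (G.surplus D H δ T nash V) h s ≤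
      h.length * (D / H) + ∑ y, G.potential D H δ T nash V h s y +
        ((Fintype.card S - 1) * H + (G.donqMemory D H δ T nash h s).V s -
          ∑ u, (G.donqMemory D H δ T nash h s).V u) := by
  classical
  induction h generalizing s with
  | nil =>
    have e1 : ∀ u : S, (G.donqMemory D H δ T nash [] s).V u = H := fun u => rfl
    simp only [e1, regret, sumRounds, potential, filtered, List.map_nil, List.sum_nil,
      List.count_nil, if_true, List.length_nil, Nat.cast_zero, Nat.zero_sub, Real.sqrt_zero,
      mul_zero, Finset.sum_const, Finset.card_univ, nsmul_eq_mul]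
    simp only [zero_mul, add_zero, sub_zero, zero_add, mul_zero]
    linarith
  | cons x past ih =>
    have h1 := ih hc.1
    have h2 := Concentrated.le_potential_sub (nash := nash) hnash hV hD hH hL hc.1 s
    have h3 : ∑ y, G.potential D H δ T nash V (x :: past) s y -
        ∑ y, G.potential D H δ T nash V past x.1 y =
        G.potential D H δ T nash V (x :: past) s x - G.potential D H δ T nash V past x.1 x := by
      rw [← Finset.sum_sub_distrib]
      refine Finset.sum_eq_single x (fun y _ hy => ?_) (fun hx => absurd (Finset.mem_univ x) hx)
      rw [potential_cons_of_ne hy, sub_self]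
    have hVm : ∀ u, (G.donqMemory D H δ T nash (x :: past) s).V u ≤
        (G.donqMemory D H δ T nash past x.1).V u :=
      (donqMemory_consistent hnash _ _).V_mono (donqMemory_consistent hnash _ _)
        (donqMemory_Qd_le x past s)
    have h4 : (G.donqMemory D H δ T nash past x.1).V s -
        (G.donqMemory D H δ T nash (x :: past) s).V s ≤
        ∑ u, (G.donqMemory D H δ T nash past x.1).V u -
          ∑ u, (G.donqMemory D H δ T nash (x :: past) s).V u := by
      rw [← Finset.sum_sub_distrib]
      exact Finset.single_le_sum (f := fun u => (G.donqMemory D H δ T nash past x.1).V u -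
        (G.donqMemory D H δ T nash (x :: past) s).V u) (fun u _ => sub_nonneg.2 (hVm u))
        (Finset.mem_univ s)
    have h5 := hJ s
    have h6 : G.regret J (x :: past) = J - G.r x.1 x.2.1 x.2.2 + G.regret J past := by
      simp only [regret, List.map_cons, List.sum_cons]
    have h7 : 1 / H * (V s + D) = 1 / H * V s + D / H := by ring
    simp only [excess, stagePayoff] at h2
    rw [h6, sumRounds, surplus, deviation, List.length_cons]
    push_cast
    linarith

/-- The excess term has a favourable sign and is dropped; Cauchy–Schwarz bounds the sum of the roots
of the counts, which add up to the number of rounds. -/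
theorem sum_potential_le (hD : 0 ≤ D) (hH : 1 < H) {h : List (S × A × B)} {s : S}
    (hy : ∀ y, 0 ≤ filtered H (G.excess D H δ T nash V) h s y) :
    ∑ y, G.potential D H δ T nash V h s y ≤
      Fintype.card (S × A × B) * H + 12 * D * √(H * Real.log (2 * T / δ)) *
        √(Fintype.card (S × A × B) * h.length) := by
  classical
  have hH0 : 0 < H := zero_lt_one.trans hH
  have hγ0 : 0 ≤ 1 - 1 / H := sub_nonneg.2 ((div_le_one hH0).2 hH.le)
  have h1 : ∀ y, G.potential D H δ T nash V h s y ≤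
      H + 12 * D * √(H * Real.log (2 * T / δ)) * √(h.count y : ℝ) := by
    intro y
    have e1 : √((h.count y - 1 : ℕ) : ℝ) ≤ √(h.count y : ℝ) :=
      Real.sqrt_le_sqrt (by exact_mod_cast Nat.sub_le _ _)
    have e2 := mul_le_mul_of_nonneg_left e1 (a := 12 * D * √(H * Real.log (2 * T / δ)))
      (by positivity)
    have e3 := mul_nonneg hγ0 (mul_nonneg (show 0 ≤ 1 + (h.count y : ℝ) / H by positivity) (hy y))
    have e4 : (if h.count y = 0 then 0 else H) ≤ H := by split_ifs <;> linarith
    rw [potential]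
    linarith
  have h2 : ∑ y, √(h.count y : ℝ) ≤ √(Fintype.card (S × A × B) * h.length) := by
    refine Real.le_sqrt_of_sq_le (sq_sum_le_card_mul_sum_sq.trans_eq ?_)
    rw [Finset.card_univ, ← sum_count_eq_length h]
    push_cast
    congr 1
    exact Finset.sum_congr rfl fun y _ => Real.sq_sqrt (by positivity)
  calc ∑ y, G.potential D H δ T nash V h s y
      ≤ ∑ y, (H + 12 * D * √(H * Real.log (2 * T / δ)) * √(h.count y : ℝ)) :=
        Finset.sum_le_sum fun y _ => h1 y
    _ = Fintype.card (S × A × B) * H +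
        12 * D * √(H * Real.log (2 * T / δ)) * ∑ y, √(h.count y : ℝ) := by
        rw [Finset.sum_add_distrib, Finset.mul_sum, Finset.sum_const, Finset.card_univ,
          nsmul_eq_mul]
    _ ≤ _ := add_le_add_right (mul_le_mul_of_nonneg_left h2 (by positivity)) _

/-- A crude bound, needed only on the histories where concentration fails. -/
theorem sumRounds_surplus_le [Nonempty B] (hnash : ∀ M, IsMatrixNash M (nash M))
    {p : S → stdSimplex ℝ A × stdSimplex ℝ B} (hV : G.IsDiscountedValue (1 - 1 / H) V p)
    (hD : 0 ≤ D) (hH : 1 < H) (h : List (S × A × B)) (s : S) :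
    sumRounds (G.surplus D H δ T nash V) h s ≤ h.length * (2 * H) := by
  have hH0 : 0 < H := zero_lt_one.trans hH
  have hγ0 : 0 ≤ 1 - 1 / H := sub_nonneg.2 ((div_le_one hH0).2 hH.le)
  have hγ1 : 1 - 1 / H < 1 := sub_lt_self _ (by positivity)
  induction h generalizing s with
  | nil => simp [sumRounds]
  | cons x past ih =>
    have h1 := donqMemory_Qd_le_horizon (G := G) (D := D) (H := H) (δ := δ) (T := T) (nash := nash)
      past x.1 x.1 x.2.1 x.2.2
    have h2 := (donqMemory_consistent (G := G) (D := D) (H := H) (δ := δ) (T := T) hnash past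
      x.1).V_nonneg (s := x.1) fun a b => (donqMemory_nonneg hnash hD hH past x.1 (x.1, a, b)).2
    have h3 := le_nextValue (G := G) (fun u => hV.nonneg hγ0 hγ1 u) x.1 x.2.1 x.2.2
    have h4 := hV.le_horizon hH s
    have h5 : (1 - 1 / H) * (V s - G.nextValue V x.1 x.2.1 x.2.2) ≤ 1 * H :=
      (mul_le_mul_of_nonneg_left (by linarith) hγ0).trans
        (mul_le_mul_of_nonneg_right hγ1.le hH0.le)
    rw [sumRounds, surplus, deviation, List.length_cons]
    push_cast
    linarith [ih x.1]

/-- The expected surplus is nonnegative. -/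
theorem expect_sumRounds_surplus_nonneg [Nonempty B] (hnash : ∀ M, IsMatrixNash M (nash M))
    (ω : List (S × A × B) → S → stdSimplex ℝ B) (s₁ : S) (n : ℕ) :
    0 ≤ G.expect (G.donqPolicy D H δ T nash) ω s₁ n
      (fun x => sumRounds (G.surplus D H δ T nash V) x.1 x.2) := by
  have h := expect_le_of_stepMean_le (G := G) (σ := G.donqPolicy D H δ T nash) (ω := ω) (s₁ := s₁)
    (F := fun x => (-1) * sumRounds (G.surplus D H δ T nash V) x.1 x.2) (fun x => ?_) n
  · rw [expect_mul_left] at h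
    simp only [sumRounds] at h
    linarith
  · rw [stepMean]
    set m := G.donqMemory D H δ T nash x.1 x.2 with hm
    have e : ∀ a b, G.nextValue (fun s' => (-1) * sumRounds (G.surplus D H δ T nash V)
        ((x.2, a, b) :: x.1) s') x.2 a b =
        (-1) * m.Qd x.2 a b + (m.V x.2 - sumRounds (G.surplus D H δ T nash V) x.1 x.2) := by
      intro a b
      have e1 : (fun s' => (-1) * sumRounds (G.surplus D H δ T nash V) ((x.2, a, b) :: x.1) s') =
          fun s' => (1 / H - 1) * V s' + ((-1) * m.Qd x.2 a b + (m.V x.2 -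
            sumRounds (G.surplus D H δ T nash V) x.1 x.2) +
              (1 - 1 / H) * G.nextValue V x.2 a b) := by
        funext s'
        simp only [sumRounds, surplus, deviation, ← hm]
        ring
      rw [e1, nextValue_add, nextValue_mul_left, nextValue_const]
      ring
    simp only [e]
    rw [mixedPayoff_add_const, mixedPayoff_mul_left]
    -- The deviation has averaged out; given the history, the opponent's action is just one mixed
    -- action, against which the maximin guarantee holds.
    have := (donqMemory_consistent (G := G) (D := D) (H := H) (δ := δ) (T := T) hnash x.1
      x.2).V_le_mixedPayoff x.2 (ω x.1 x.2)
    rw [← hm] at this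
    have e2 : G.donqPolicy D H δ T nash x.1 x.2 = m.μ x.2 := rfl
    rw [e2]
    linarith

end Regret

end StochasticGame

namespace DonqMemory

/-! ### The weights of the observations -/

/-- The factor by which the rounds after the `n`-th discount an average over `τ` rounds. -/
noncomputable def tailRate (H : ℝ) (n τ : ℕ) : ℝ := ∏ i ∈ Finset.Ico n τ, (1 - rate H (i + 1))

/-- The weight of the observation number `n` (from `0`) in the average over `τ` rounds. -/
noncomputable def weight (H : ℝ) (τ n : ℕ) : ℝ :=
  if n < τ then rate H (n + 1) * tailRate H (n + 1) τ else 0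

theorem tailRate_self (H : ℝ) (τ : ℕ) : tailRate H τ τ = 1 := by
  rw [tailRate, Finset.Ico_self, Finset.prod_empty]

theorem tailRate_eq_mul (H : ℝ) {n τ : ℕ} (h : n < τ) :
    tailRate H n τ = (1 - rate H (n + 1)) * tailRate H (n + 1) τ :=
  Finset.prod_eq_prod_Ico_succ_bot h _

theorem tailRate_succ (H : ℝ) {n τ : ℕ} (h : n ≤ τ) :
    tailRate H n (τ + 1) = tailRate H n τ * (1 - rate H (τ + 1)) :=
  Finset.prod_Ico_succ_top h _

/-- This is the variance proxy of the averaged noise. Each further visit multiplies the sum by `(1 -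
α)²` and adds `α²`. -/
theorem sum_sq_weight_le {H : ℝ} (hH : 1 < H) (τ : ℕ) :
    ∑ n ∈ Finset.range (τ + 1), weight H (τ + 1) n ^ 2 ≤ 2 * H / (τ + 1 : ℕ) := by
  have hH0 : 0 < H := zero_lt_one.trans hH
  induction τ with
  | zero =>
    rw [Finset.sum_range_one, weight, if_pos (Nat.lt_succ_self 0), zero_add, rate_one hH0,
      tailRate_self]
    norm_num
    linarith
  | succ τ ih =>
    rw [Finset.sum_range_succ]
    have h1 : ∀ n ∈ Finset.range (τ + 1), weight H (τ + 1 + 1) n ^ 2 =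
        (1 - rate H (τ + 1 + 1)) ^ 2 * weight H (τ + 1) n ^ 2 := by
      intro n hn
      have hn' := Finset.mem_range.1 hn
      rw [weight, weight, if_pos hn', if_pos (hn'.trans (Nat.lt_succ_self _)),
        tailRate_succ H hn']
      ring
    rw [Finset.sum_congr rfl h1, ← Finset.mul_sum, weight, if_pos (Nat.lt_succ_self _),
      tailRate_self, mul_one]
    have hr := mul_rate_succ hH0 (τ + 1)
    have ht : (0 : ℝ) < ((τ + 1 : ℕ) : ℝ) := by positivity
    have hs : (((τ + 1 + 1 : ℕ)) : ℝ) = ((τ + 1 : ℕ) : ℝ) + 1 := by push_cast; ring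
    have h2 := mul_le_mul_of_nonneg_left ih (sq_nonneg (1 - rate H (τ + 1 + 1)))
    rw [hs]
    generalize ((τ + 1 : ℕ) : ℝ) = t at *
    have hα : rate H (τ + 1 + 1) = (H + 1) / (H + t + 1) := by
      rw [eq_div_iff (by positivity)]
      linarith
    rw [hα] at h2 ⊢
    refine (add_le_add_left h2 _).trans ?_
    have e : (1 - (H + 1) / (H + t + 1)) ^ 2 * (2 * H / t) + ((H + 1) / (H + t + 1)) ^ 2 =
        (2 * H * t + (H + 1) ^ 2) / (H + t + 1) ^ 2 := by
      field_simp
      ring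
    rw [e, div_le_div_iff₀ (by positivity) (by positivity)]
    nlinarith [mul_pos ht hH0, pow_pos hH0 3, mul_pos hH0 hH0, mul_pos ht (mul_pos hH0 hH0),
      mul_nonneg ht.le (mul_nonneg (sub_nonneg.2 hH.le) (sub_nonneg.2 hH.le)),
      mul_nonneg ht.le (sub_nonneg.2 hH.le)]

theorem sum_sq_weight_range_le {H : ℝ} (τ n : ℕ) :
    ∑ i ∈ Finset.range n, weight H τ i ^ 2 ≤ ∑ i ∈ Finset.range τ, weight H τ i ^ 2 := by
  calc ∑ i ∈ Finset.range n, weight H τ i ^ 2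
      ≤ ∑ i ∈ Finset.range (max τ n), weight H τ i ^ 2 :=
        Finset.sum_le_sum_of_subset_of_nonneg
          (Finset.range_subset_range.2 (le_max_right _ _)) fun i _ _ => sq_nonneg _
    _ = ∑ i ∈ Finset.range τ, weight H τ i ^ 2 := by
        refine (Finset.sum_subset (Finset.range_subset_range.2 (le_max_left _ _))
          fun i _ hi => ?_).symm
        rw [weight, if_neg (mt Finset.mem_range.2 hi), zero_pow two_ne_zero]

end DonqMemory

section Weighted

variable {S A B : Type*}

open Classical in
/-- The sum of the observations made when `y` was played, the one number `n` with weight `w n`. -/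
noncomputable def weightedSum (w : ℕ → ℝ) (X : List (S × A × B) → S × A × B → S → ℝ)
    (y : S × A × B) : List (S × A × B) → S → ℝ
  | [], _ => 0
  | x :: past, s' => weightedSum w X y past x.1 +
      if y = x then w (past.count y) * X past x s' else 0

variable {H : ℝ} {X : List (S × A × B) → S × A × B → S → ℝ}

open Classical in
-- The weights in `filtered` change at each visit, so it is not a martingale. Fixing the final count
-- `τ` freezes them; at `count = τ` the factor is `1` and the two agree.
theorem weightedSum_weight (y : S × A × B) (τ : ℕ) (h : List (S × A × B)) (s : S)
    (hτ : h.count y ≤ τ) :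
    weightedSum (DonqMemory.weight H τ) X y h s =
      DonqMemory.tailRate H (h.count y) τ * filtered H X h s y := by
  induction h generalizing s with
  | nil => simp [weightedSum, filtered]
  | cons x past ih =>
    by_cases hxy : y = x
    · subst hxy
      rw [List.count_cons_self] at hτ ⊢
      rw [weightedSum, if_pos rfl, ih y.1 (by omega), filtered_cons_self,
        DonqMemory.tailRate_eq_mul H hτ, DonqMemory.weight, if_pos (Nat.lt_of_succ_le hτ)]
      ring
    · rw [List.count_cons_of_ne (Ne.symm hxy)] at hτ ⊢
      rw [weightedSum, if_neg hxy, add_zero, ih x.1 hτ, filtered_cons_of_ne hxy]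

end Weighted

/-! ### Concentration of the averaged deviations -/

namespace StochasticGame

section Failure

variable {S A B : Type*} [Fintype S] {G : StochasticGame S A B} {D H δ : ℝ} {T : ℕ} {V : S → ℝ}

open Classical in
-- The weights vanish from index `τ` on, so the sum is frozen after the `τ`-th visit: a violation at
-- any time is still visible at the end, and no stopping time is needed.
theorem exists_lt_abs_of_not_concentrated {h : List (S × A × B)} {s : S}
    (hc : ¬G.Concentrated D H δ T V h s) :
    ∃ (y : S × A × B) (τ : ℕ), 0 < τ ∧ τ ≤ h.count y ∧ DonqMemory.bonus D H δ T τ <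
      |weightedSum (DonqMemory.weight H τ) (G.deviation V) y h s| := by
  induction h generalizing s with
  | nil => exact absurd trivial hc
  | cons x past ih =>
    by_cases hp : G.Concentrated D H δ T V past x.1
    · refine ⟨x, (x :: past).count x, ?_, le_rfl, ?_⟩
      · rw [List.count_cons_self]
        positivity
      · rw [weightedSum_weight x _ _ _ le_rfl, DonqMemory.tailRate_self, one_mul]
        exact not_le.1 fun hle => hc ⟨hp, hle⟩
    · obtain ⟨y, τ, h0, h1, h2⟩ := ih hp
      refine ⟨y, τ, h0, h1.trans ((List.sublist_cons_self x past).count_le y), ?_⟩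
      have : (if y = x then DonqMemory.weight H τ (past.count y) * G.deviation V past x s
          else 0) = 0 := by
        rw [DonqMemory.weight, if_neg (not_lt.2 h1), zero_mul, ite_self]
      rwa [weightedSum, this, add_zero]

/-- Covers `D = 0`, where `V` is constant and the Chernoff parameter, which has `D²` in its
denominator, is not available. -/
theorem concentrated_of_deviation_eq_zero (hD : 0 ≤ D)
    (hdev : ∀ past x s', G.deviation V past x s' = 0) (h : List (S × A × B)) (s : S) :
    G.Concentrated D H δ T V h s := by
  have hf : ∀ (h : List (S × A × B)) (s : S) y, filtered H (G.deviation V) h s y = 0 := by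
    intro h
    induction h with
    | nil => exact fun _ _ => rfl
    | cons x past ih =>
      intro s y
      by_cases hxy : y = x
      · subst hxy
        rw [filtered_cons_self, ih, hdev, mul_zero, mul_zero, add_zero]
      · rw [filtered_cons_of_ne hxy, ih]
  induction h generalizing s with
  | nil => trivial
  | cons x past ih =>
    refine ⟨ih x.1, ?_⟩
    rw [hf, abs_zero]
    exact DonqMemory.bonus_nonneg hD _

end Failure

section Concentration

variable {S A B : Type*} [Fintype S] [Fintype A] [Fintype B] {G : StochasticGame S A B}
  {σ : List (S × A × B) → S → stdSimplex ℝ A} {ω : List (S × A × B) → S → stdSimplex ℝ B} {s₁ : S}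
  {D H δ : ℝ} {T : ℕ} {V : S → ℝ}

open Classical in
/-- The exponential supermartingale of a weighted sum of deviations. -/
theorem expect_exp_weightedSum_le {c d : ℝ} (hV : ∀ s, V s ∈ Set.Icc c (c + d)) (w : ℕ → ℝ)
    (y : S × A × B) (l : ℝ) (n : ℕ) :
    G.expect σ ω s₁ n (fun x => Real.exp (l * weightedSum w (G.deviation V) y x.1 x.2 -
      l ^ 2 * d ^ 2 / 8 * ∑ i ∈ Finset.range (x.1.count y), w i ^ 2)) ≤ 1 := by
  refine (expect_le_of_stepMean_le (F := fun x : List (S × A × B) × S =>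
    Real.exp (l * weightedSum w (G.deviation V) y x.1 x.2 -
      l ^ 2 * d ^ 2 / 8 * ∑ i ∈ Finset.range (x.1.count y), w i ^ 2))
    (fun ⟨past, s⟩ => ?_) n).trans_eq (by simp [weightedSum])
  simp only [stepMean]
  refine le_trans (mixedPayoff_mono fun a b => ?_) (mixedPayoff_const _).le
  by_cases hy : y = (s, a, b)
  · have hcount : ((s, a, b) :: past).count y = past.count y + 1 := by
      rw [hy, List.count_cons_self]
    set u := w (past.count y) with hu
    set K := l * weightedSum w (G.deviation V) y past s -
      l ^ 2 * d ^ 2 / 8 * ∑ i ∈ Finset.range (past.count y), w i ^ 2 with hK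
    -- The new weight depends only on the past count, so Hoeffding's lemma applies with parameter `l
    -- * u`.
    have e : (fun s' => Real.exp (l * weightedSum w (G.deviation V) y ((s, a, b) :: past) s' -
        l ^ 2 * d ^ 2 / 8 * ∑ i ∈ Finset.range (((s, a, b) :: past).count y), w i ^ 2)) =
        fun s' => Real.exp (K - (l * u) ^ 2 * d ^ 2 / 8) *
          Real.exp ((l * u) * (V s' - ∑ v, G.P s a b v * V v)) := by
      funext s'
      rw [← Real.exp_add, hcount, Finset.sum_range_succ, weightedSum, if_pos hy, deviation,
        nextValue]
      congr 1
      rw [hK, hu]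
      ring
    rw [e, nextValue_mul_left]
    have := mul_le_mul_of_nonneg_left (stdSimplex_sum_mul_exp_le (G.P s a b) V hV (l * u))
      (Real.exp_pos (K - (l * u) ^ 2 * d ^ 2 / 8)).le
    rw [← Real.exp_add, sub_add_cancel] at this
    exact this
  · have hcount : ((s, a, b) :: past).count y = past.count y :=
      List.count_cons_of_ne (Ne.symm hy)
    simp only [hcount, weightedSum, if_neg hy, add_zero]
    exact (nextValue_const _ _ _ _).le

open Classical in
/-- The Azuma–Hoeffding inequality for the averaged deviations. -/
theorem expect_bonus_lt_abs_le {c : ℝ} (hV : ∀ s, V s ∈ Set.Icc c (c + D)) (hD : 0 < D)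
    (hH : 1 < H) (hL : 0 ≤ Real.log (2 * T / δ)) (y : S × A × B) (τ n : ℕ) :
    G.expect σ ω s₁ n (fun x => if DonqMemory.bonus D H δ T (τ + 1) <
      |weightedSum (DonqMemory.weight H (τ + 1)) (G.deviation V) y x.1 x.2| then 1 else 0) ≤
      2 * Real.exp (-4 * Real.log (2 * T / δ)) := by
  have hH0 : 0 < H := zero_lt_one.trans hH
  set ε := DonqMemory.bonus D H δ T (τ + 1) with hε
  set w := DonqMemory.weight H (τ + 1) with hw
  set L := Real.log (2 * T / δ) with hLdef
  have ht : (0 : ℝ) < ((τ + 1 : ℕ) : ℝ) := by positivity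
  set v : ℝ := 2 * H / (τ + 1 : ℕ) with hv
  have hv0 : 0 < v := by positivity
  have hε0 : 0 ≤ ε := DonqMemory.bonus_nonneg hD.le _
  have hε2 : ε ^ 2 = 2 * D ^ 2 * L * v := by
    rw [hε, DonqMemory.bonus, mul_pow, Real.sq_sqrt (by positivity), hv]
    ring
  -- The minimizer of `l² D² v / 8 - l ε`; the minimum is `-2 ε² / (D² v) = -4L`.
  set l : ℝ := 4 * ε / (D ^ 2 * v) with hl
  have hexp : l ^ 2 * D ^ 2 / 8 * v - l * ε = -4 * L := by
    have : l ^ 2 * D ^ 2 / 8 * v - l * ε = -(2 * ε ^ 2 / (D ^ 2 * v)) := by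
      rw [hl]
      field_simp
      ring
    rw [this, hε2]
    field_simp
    ring
  let F : ℝ → List (S × A × B) × S → ℝ := fun l x =>
    Real.exp (l * weightedSum w (G.deviation V) y x.1 x.2 -
      l ^ 2 * D ^ 2 / 8 * ∑ i ∈ Finset.range (x.1.count y), w i ^ 2)
  have key : ∀ x : List (S × A × B) × S,
      (if ε < |weightedSum w (G.deviation V) y x.1 x.2| then (1 : ℝ) else 0) ≤
        Real.exp (-4 * L) * (F l x + F (-l) x) := by
    intro x
    split_ifs with h
    · have hsum : l ^ 2 * D ^ 2 / 8 * ∑ i ∈ Finset.range (x.1.count y), w i ^ 2 ≤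
          l ^ 2 * D ^ 2 / 8 * v :=
        mul_le_mul_of_nonneg_left ((DonqMemory.sum_sq_weight_range_le _ _).trans
          (DonqMemory.sum_sq_weight_le hH τ)) (by positivity)
      have hl0 : 0 ≤ l := by positivity
      rw [mul_add, ← Real.exp_add, ← Real.exp_add]
      rcases lt_abs.1 h with h | h
      · have h1 := mul_le_mul_of_nonneg_left h.le hl0
        have := Real.one_le_exp (x := -4 * L + (l * weightedSum w (G.deviation V) y x.1 x.2 -
          l ^ 2 * D ^ 2 / 8 * ∑ i ∈ Finset.range (x.1.count y), w i ^ 2)) (by linarith)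
        exact this.trans (le_add_of_nonneg_right (Real.exp_pos _).le)
      · have h1 := mul_le_mul_of_nonneg_left h.le hl0
        have := Real.one_le_exp (x := -4 * L + (-l * weightedSum w (G.deviation V) y x.1 x.2 -
          (-l) ^ 2 * D ^ 2 / 8 * ∑ i ∈ Finset.range (x.1.count y), w i ^ 2)) (by
            rw [neg_sq]
            linarith)
        exact this.trans (le_add_of_nonneg_left (Real.exp_pos _).le)
    · positivity
  calc G.expect σ ω s₁ n (fun x => if ε < |weightedSum w (G.deviation V) y x.1 x.2| then 1 else 0)
      ≤ G.expect σ ω s₁ n (fun x => Real.exp (-4 * L) * (F l x + F (-l) x)) :=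
        expect_mono fun x _ => key x
    _ = Real.exp (-4 * L) * (G.expect σ ω s₁ n (F l) + G.expect σ ω s₁ n (F (-l))) := by
        rw [expect_mul_left, expect_add]
    _ ≤ Real.exp (-4 * L) * (1 + 1) := by
        refine mul_le_mul_of_nonneg_left (add_le_add ?_ ?_) (Real.exp_pos _).le
        · exact expect_exp_weightedSum_le hV w y l n
        · exact expect_exp_weightedSum_le hV w y (-l) n
    _ = 2 * Real.exp (-4 * L) := by ring

open Classical in
-- A union bound over the triples and the possible counts.
theorem expect_not_concentrated_le {c : ℝ} (hV : ∀ s, V s ∈ Set.Icc c (c + D)) (hD : 0 ≤ D)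
    (hH : 1 < H) (hL : 0 ≤ Real.log (2 * T / δ)) (n : ℕ) :
    G.expect σ ω s₁ n (fun x => if G.Concentrated D H δ T V x.1 x.2 then 0 else 1) ≤
      Fintype.card (S × A × B) * n * (2 * Real.exp (-4 * Real.log (2 * T / δ))) := by
  rcases hD.eq_or_lt with hD0 | hD0
  · have hconst : ∀ s, V s = c := fun s => by
      have := hV s
      rw [← hD0, add_zero, Set.Icc_self] at this
      exact this
    have hc : ∀ x : List (S × A × B) × S, G.Concentrated D H δ T V x.1 x.2 := fun x =>
      concentrated_of_deviation_eq_zero hD (fun past z s' => by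
        rw [deviation, show V = fun _ => c from funext hconst, nextValue_const, sub_self]) _ _
    simp only [hc, if_true, expect_const]
    positivity
  · let I : S × A × B → ℕ → List (S × A × B) × S → ℝ := fun y τ x =>
      if DonqMemory.bonus D H δ T (τ + 1) <
        |weightedSum (DonqMemory.weight H (τ + 1)) (G.deviation V) y x.1 x.2| then 1 else 0
    have hI : ∀ y τ x, 0 ≤ I y τ x := fun y τ x => by
      simp only [I]
      split_ifs <;> norm_num
    calc G.expect σ ω s₁ n (fun x => if G.Concentrated D H δ T V x.1 x.2 then 0 else 1)
        ≤ G.expect σ ω s₁ n (fun x => ∑ y, ∑ τ ∈ Finset.range n, I y τ x) := by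
          refine expect_mono fun x hx => ?_
          split_ifs with h
          · exact Finset.sum_nonneg fun y _ => Finset.sum_nonneg fun τ _ => hI y τ x
          · obtain ⟨y, τ, h0, h1, h2⟩ := exists_lt_abs_of_not_concentrated h
            obtain ⟨τ, rfl⟩ := Nat.exists_eq_succ_of_ne_zero h0.ne'
            have h3 : τ ∈ Finset.range n :=
              Finset.mem_range.2 (h1.trans (List.count_le_length.trans_eq hx))
            calc (1 : ℝ) = I y τ x := (if_pos h2).symm
              _ ≤ ∑ τ ∈ Finset.range n, I y τ x :=
                Finset.single_le_sum (f := fun τ => I y τ x) (fun τ _ => hI y τ x) h3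
              _ ≤ ∑ y, ∑ τ ∈ Finset.range n, I y τ x :=
                Finset.single_le_sum (f := fun y => ∑ τ ∈ Finset.range n, I y τ x)
                  (fun y _ => Finset.sum_nonneg fun τ _ => hI y τ x) (Finset.mem_univ y)
      _ = ∑ y, ∑ τ ∈ Finset.range n, G.expect σ ω s₁ n (I y τ) := by
          rw [expect_sum]
          exact Finset.sum_congr rfl fun y _ => expect_sum _ _ _
      _ ≤ ∑ _y : S × A × B, ∑ _τ ∈ Finset.range n,
            2 * Real.exp (-4 * Real.log (2 * T / δ)) :=
          Finset.sum_le_sum fun y _ => Finset.sum_le_sum fun τ _ =>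
            expect_bonus_lt_abs_le hV hD0 hH hL y τ n
      _ = _ := by
          rw [Finset.sum_const, Finset.sum_const, Finset.card_univ, Finset.card_range]
          simp only [nsmul_eq_mul]
          ring

end Concentration

end StochasticGame

/-! ### Assembling the bound -/

theorem theorem2 :
    ∃ C : ℝ, ∀ (S A B : Type*) [Fintype S] [Fintype A] [Fintype B] [Nonempty A] [Nonempty B]
      (G : StochasticGame S A B) (_ : G.Communicating)
      (D : ℝ≥0) (_ : G.diameter ≤ (D : ℝ≥0∞))
      (H : ℝ) (_ : 1 < H) (T : ℕ) (_ : 1 ≤ T)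
      (nash : (A → B → ℝ) → stdSimplex ℝ A × stdSimplex ℝ B) (_ : ∀ M, IsMatrixNash M (nash M))
      (ω : List (S × A × B) → S → stdSimplex ℝ B) (s₁ : S),
      ∃ J : ℝ, G.IsValue J ∧
        G.expect (G.donqPolicy D H (1 / T) T nash) ω s₁ T (fun h => G.regret J h.1) ≤
          D * T / H +
            12 * D * √(Fintype.card S * Fintype.card A * Fintype.card B * H * T *
              Real.log (2 * (T : ℝ) ^ 2)) +
            C * (Fintype.card S * Fintype.card A * Fintype.card B * H +
              D * √(T * Real.log (4 * T))) := by
  -- In units of `S A B H`: one for the first visits, one for the telescoped value estimators, three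
  -- for the failure of concentration.
  refine ⟨5, ?_⟩
  intro S A B _ _ _ _ _ G _ D hdiam H hH T hT nash hnash ω s₁
  have : Nonempty S := ⟨s₁⟩
  obtain ⟨J, hJ⟩ := StochasticGame.exists_isValue (G := G) hnash hdiam
  refine ⟨J, hJ, ?_⟩
  have hH0 : 0 < H := zero_lt_one.trans hH
  have hγ0 : 0 ≤ 1 - 1 / H := sub_nonneg.2 ((div_le_one hH0).2 hH.le)
  have hγ1 : 1 - 1 / H < 1 := sub_lt_self _ (by positivity)
  have hT1 : (1 : ℝ) ≤ T := by exact_mod_cast hT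
  have hT0 : (0 : ℝ) < T := zero_lt_one.trans_le hT1
  have hD : (0 : ℝ) ≤ D := D.coe_nonneg
  set N : ℝ := Fintype.card S * Fintype.card A * Fintype.card B with hN
  have hcard : (Fintype.card (S × A × B) : ℝ) = N := by
    rw [Fintype.card_prod, Fintype.card_prod]
    push_cast
    ring
  have hlogarg : 2 * (T : ℝ) / (1 / T) = 2 * (T : ℝ) ^ 2 := by
    field_simp
  have hL : 0 ≤ Real.log (2 * T / (1 / T)) := by
    rw [hlogarg]
    exact Real.log_nonneg (by nlinarith)
  have hJ1 := (hJ.mem_Icc s₁).2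
  have hSN : (Fintype.card S : ℝ) ≤ N := by
    have hA : (1 : ℝ) ≤ Fintype.card A := by exact_mod_cast Fintype.card_pos
    have hB : (1 : ℝ) ≤ Fintype.card B := by exact_mod_cast Fintype.card_pos
    have hS : (0 : ℝ) ≤ Fintype.card S := Nat.cast_nonneg _
    calc (Fintype.card S : ℝ) ≤ Fintype.card S * Fintype.card A := le_mul_of_one_le_right hS hA
      _ ≤ N := le_mul_of_one_le_right (by positivity) hB
  have hS1 : (1 : ℝ) ≤ Fintype.card S := by exact_mod_cast Fintype.card_pos
  have hN1 : 1 ≤ N := hS1.trans hSN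
  have hlast : 0 ≤ D * √(T * Real.log (4 * T)) := by positivity
  set M : ℝ := D * T / H + 12 * D * √(N * H * T * Real.log (2 * (T : ℝ) ^ 2)) with hM
  have hM0 : 0 ≤ M := by positivity
  suffices h : G.expect (G.donqPolicy D H (1 / T) T nash) ω s₁ T (fun h => G.regret J h.1) ≤
      M + 5 * (N * H) by linarith
  -- If `T < S A B`, the trivial bound `T` on the regret suffices; otherwise `N ≤ T` removes the
  -- number of triples from the failure probability.
  rcases lt_or_ge (T : ℝ) N with hTN | hNT
  · have h1 := StochasticGame.expect_mono (G := G) (σ := G.donqPolicy D H (1 / T) T nash) (ω := ω)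
      (s₁ := s₁) (n := T) (f := fun h => G.regret J h.1) (g := fun _ => (T : ℝ)) fun x hx =>
        (StochasticGame.regret_le_length hJ1 x.1).trans_eq (by rw [hx])
    rw [StochasticGame.expect_const] at h1
    nlinarith
  classical
  obtain ⟨V, hV⟩ := StochasticGame.exists_isDiscountedValue (G := G) hnash hγ0 hγ1
  obtain ⟨m, hm⟩ := Finite.exists_min V
  have hVspan : ∀ s, V s ∈ Set.Icc (V m) (V m + D) := fun s =>
    ⟨hm s, hV.le_add_diameter hγ0 hγ1 hdiam m s⟩
  have hJV : ∀ s, J ≤ 1 / H * (V s + D) := fun s => by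
    have := hJ.le_of_isDiscountedValue hV hγ0 hγ1 hdiam s
    rwa [sub_sub_cancel] at this
  let W : List (S × A × B) × S → ℝ := fun x =>
    sumRounds (G.surplus D H (1 / T) T nash V) x.1 x.2
  let bad : List (S × A × B) × S → ℝ := fun x =>
    if G.Concentrated D H (1 / T) T V x.1 x.2 then 0 else 1
  -- On bad histories, regret plus surplus is at most `T + 2 T H ≤ 3 T H`.
  have hpath : ∀ x : List (S × A × B) × S, x.1.length = T → G.regret J x.1 ≤
      (M + 2 * (N * H)) + ((-1) * W x + 3 * T * H * bad x) := by
    intro x hx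
    by_cases hc : G.Concentrated D H (1 / T) T V x.1 x.2
    · have h1 := hc.regret_le hnash hV hD hH hL hJV
      have h2 := StochasticGame.sum_potential_le (δ := 1 / T) (T := T) hD hH
        (hc.optimism hnash hV hD hH hL).1
      have h3 := (StochasticGame.donqMemory_consistent (G := G) (D := D) (H := H) (δ := 1 / T)
        (T := T) hnash x.1 x.2)
      have h4 : (G.donqMemory D H (1 / T) T nash x.1 x.2).V x.2 ≤
          ∑ u, (G.donqMemory D H (1 / T) T nash x.1 x.2).V u :=
        Finset.single_le_sum (f := (G.donqMemory D H (1 / T) T nash x.1 x.2).V)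
          (fun u _ => h3.V_nonneg fun a b =>
            (StochasticGame.donqMemory_nonneg hnash hD hH x.1 x.2 (u, a, b)).2)
          (Finset.mem_univ x.2)
      have h5 : √(H * Real.log (2 * T / (1 / T))) * √(N * T) =
          √(N * H * T * Real.log (2 * (T : ℝ) ^ 2)) := by
        rw [← Real.sqrt_mul (by positivity), hlogarg]
        congr 1
        ring
      have h6 : (Fintype.card S : ℝ) * H ≤ N * H := mul_le_mul_of_nonneg_right hSN hH0.le
      rw [hcard, hx, mul_assoc (12 * (D : ℝ)), h5] at h2
      rw [hx] at h1
      have h7 : (T : ℝ) * (D / H) = D * T / H := by ring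
      have h8 : bad x = 0 := if_pos hc
      rw [h8]
      simp only [W]
      linarith
    · have h1 := StochasticGame.regret_le_length (G := G) hJ1 x.1
      have h2 := StochasticGame.sumRounds_surplus_le (δ := 1 / T) (T := T) hnash hV hD hH x.1 x.2
      have h8 : bad x = 1 := if_neg hc
      rw [hx] at h1 h2
      rw [h8]
      simp only [W]
      nlinarith
  have hbad : G.expect (G.donqPolicy D H (1 / T) T nash) ω s₁ T bad ≤ 1 / T := by
    have h1 := StochasticGame.expect_not_concentrated_le (G := G) (σ :=
      G.donqPolicy D H (1 / T) T nash)
      (ω := ω) (s₁ := s₁) hVspan hD hH hL T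
    have h2 : Real.exp (-4 * Real.log (2 * T / (1 / T))) = ((2 * (T : ℝ) ^ 2) ^ 4)⁻¹ := by
      rw [hlogarg, neg_mul, Real.exp_neg, mul_comm, Real.exp_mul, Real.exp_log (by positivity)]
      norm_num
    rw [h2, hcard] at h1
    refine h1.trans ?_
    -- A probability of `1/T` is all that is needed to reduce `3 T H` to `3 H`.
    calc N * T * (2 * ((2 * (T : ℝ) ^ 2) ^ 4)⁻¹) ≤ T * T * (2 * ((2 * (T : ℝ) ^ 2) ^ 4)⁻¹) := by
          gcongr
      _ = 1 / (8 * T ^ 6) := by field_simp; norm_num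
      _ ≤ 1 / T := by
          refine one_div_le_one_div_of_le hT0 ?_
          have := le_self_pow₀ hT1 (n := 6) (by norm_num)
          linarith
  have hW : 0 ≤ G.expect (G.donqPolicy D H (1 / T) T nash) ω s₁ T W :=
    StochasticGame.expect_sumRounds_surplus_nonneg hnash ω s₁ T
  have hfin := StochasticGame.expect_mono (G := G) (σ := G.donqPolicy D H (1 / T) T nash) (ω := ω)
    (s₁ := s₁) (f := fun h => G.regret J h.1) hpath
  rw [StochasticGame.expect_add, StochasticGame.expect_const, StochasticGame.expect_add,
    StochasticGame.expect_mul_left, StochasticGame.expect_mul_left] at hfin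
  have h9 : 3 * T * H * G.expect (G.donqPolicy D H (1 / T) T nash) ω s₁ T bad ≤ 3 * H :=
    (mul_le_mul_of_nonneg_left hbad (by positivity)).trans_eq (by field_simp)
  have h10 : 1 * H ≤ N * H := mul_le_mul_of_nonneg_right hN1 hH0.le
  linarith
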